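/- **Setup.** All posets and groups are finite, and $R(G)$ denotes the complex representation ring of a group $G$. Let $\Gamma$ be a lower Eulerian poset with rank function $\rho_\Gamma$: $\Gamma$ has a least element $\hat 0_\Gamma$, $\rho_\Gamma(z')=\rho_\Gamma(z)+1$ whenever $z'$ covers $z$, and $\sum_{z\le z''\le z'}(-1)^{\rho_\Gamma(z'')}=0$ for all $z<z'$. Let $q\ne\hat 0_\Gamma$ be an element such that all joins $z\vee q$ exist. Put $Y=\{z: q\le z\}$, $X=\Gamma\smallsetminus Y$ and $\sigma:X\to Y$, $\sigma(x)=x\vee q$. Let a finite group $W$ act on $\Gamma$ by order-preserving maps that preserve $\rho_\Gamma$ and fix $q$, and assume that the action is Eulerian: for every $w\in W$ the fixed poset $\Gamma^w$ is lower Eulerian. For $z\le z''\le z'$ let $W_{z,z'}=W_z\cap W_{z'}$ and $W_{z,z'',z'}=W_z\cap W_{z''}\cap W_{z'}$ be intersections of stabilizers. The equivariant incidence algebra $I^W(\Gamma)$ is the set of families $p=(p(z,z')\in R(W_{z,z'})[t])_{z\le z'}$ such that $p(z,z')$ is the pullback of $p(wz,wz')$ along conjugation by $w$, for all $w\in W$.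 Addition and $\mathbb Z[t]$-scalar multiplication are defined interval by interval, and $$(p\cdot p')(z,z')=\sum_{z\le z''\le z'}\frac{|W_{z,z'',z'}|}{|W_{z,z'}|}\operatorname{Ind}_{W_{z,z'',z'}}^{W_{z,z'}}\Big(\operatorname{Res}^{W_{z,z''}}_{W_{z,z'',z'}}p(z,z'')\cdot\operatorname{Res}^{W_{z'',z'}}_{W_{z,z'',z'}}p'(z'',z')\Big),$$ where the fractions are removed by summing over representatives $z''$ of the $W_{z,z'}$-orbits of $[z,z']$. The identity $\delta$ has $\delta(z,z)=1$ and $\delta(z,z')=0$ for $z<z'$. Fix a $W$-invariant weak rank function $r$, i.e. integers $r(z,z')\ge 0$ for $z\le z'$ with $r(z,z')>0$ for $z<z'$, $r(z,z')=r(z,z'')+r(z'',z')$ for $z\le z''\le z'$, and $r(wz,wz')=r(z,z')$. Put $\mathscr I=\{p\in I^W(\Gamma):\deg p(z,z')\le r(z,z')\}$, $\mathscr I_{1/2}=\{p\in\mathscr I:\deg p(z,z')<r(z,z')/2\text{ for } z<z'\}$ and $U=\{p\in I^W(\Gamma):p(z,z)=1\}$. For $p\in\mathscr I$ define: * $p^{\mathrm{rev}}(z,z';t)=t^{r(z,z')}p(z,z';t^{-1})$;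 * $\Delta p$, by $(\Delta p)(z,z)=0$ and $(\Delta p)(z,z')=p_0+\sum_{i=1}^{\lfloor (r(z,z')-1)/2\rfloor}(p_i-p_{i-1})t^i$ for $z<z'$, where $p_i$ is the coefficient of $t^i$ in $p(z,z')$; * $\widehat p\in\mathscr I\otimes_{\mathbb Z}\mathbb C$, by $\mathrm{ev}_w(\widehat p(z,z'))=(-1)^{\rho_w(z')-\rho_w(z)}\,\mathrm{ev}_w(p(z,z'))$ for all $w\in W$ and $z\le z'$ in $\Gamma^w$, where $\mathrm{ev}_w$ evaluates characters at $w$ coefficientwise and $\rho_w$ is a rank function of $\Gamma^w$; * $p|_X$, $p|_Y$, $p|_{X/Y}$ and $p|_{(X/Y)^\circ}$, which agree with $p$ on the intervals $[z,z']$ with, respectively, $z,z'\in X$; $z,z'\in Y$; $z\in X$ and $z'\in Y$; $z\in X$ and $z'=\sigma(z)$; and vanish on all other intervals. Let $\kappa\in\mathscr I\cap U$ be rank alternating, i.e. $\kappa^{\mathrm{rev}}=\widehat\kappa$, and multiplicative, i.e. $\mathrm{ev}_w(\kappa(z,z'))=\mathrm{ev}_w(\kappa(z,z''))\,\mathrm{ev}_w(\kappa(z'',z'))$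 for all $w\in W$ and all $z\le z''\le z'$ in $\Gamma^w$. **Theorem.** (a) $\kappa$ is an equivariant kernel, i.e. $\kappa^{-1}=\kappa^{\mathrm{rev}}$. There are unique $f,g\in\mathscr I_{1/2}\cap U$ with $f^{\mathrm{rev}}=\kappa\cdot f$ and $g^{\mathrm{rev}}=g\cdot\kappa$, and $g$ has a unique inverse in $I^W(\Gamma)$. There is a unique $h_\sigma\in\mathscr I$ with $(t-1)\,h_\sigma=g\cdot\kappa|_{(X/Y)^\circ}$. Put $\ell_\sigma=h_\sigma\cdot g^{-1}$ and $Z=g\cdot\kappa\cdot f$. Then $\ell_\sigma\in\mathscr I$, and $\widehat{\ell_\sigma}$ and $\widehat f$ lie in $\mathscr I$. (b) The following identities hold in $I^W(\Gamma)$: $$g|_{X/Y}=\Delta\ell_\sigma\cdot g=\Delta\ell_\sigma\cdot g|_Y,$$ $$f|_{X/Y}=-f\cdot\Delta\widehat{\ell_\sigma}=-f|_X\cdot\Delta\widehat{\ell_\sigma},$$ $$Z|_{X/Y}=-Z|_X\cdot\Delta\widehat{\ell_\sigma}+(\Delta\ell_\sigma)^{\mathrm{rev}}\cdot Z|_Y.$$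 (c) $\Delta\ell_\sigma=g|_{X/Y}\cdot g^{-1}=g|_{X/Y}\cdot\widehat f$. -/

import Mathlib

open Polynomial

namespace EquivKLS

noncomputable section

/-! ## The complex representation ring of a group -/

/-- The `n`-dimensional complex representations of `G` on the spaces `ℂⁿ`. Every finite-dimensional
complex representation is isomorphic to one of these. -/
abbrev MatRep (G : Type*) [Group G] : Type _ :=
  Σ n : ℕ, Representation ℂ G (Fin n → ℂ)

/-- Isomorphism of representations. -/
def matRepSetoid (G : Type*) [Group G] : Setoid (MatRep G) where
  r a b := Nonempty (a.2.Equiv b.2)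
  iseqv :=
    ⟨fun a => ⟨Representation.Equiv.refl a.2⟩, fun ⟨e⟩ => ⟨e.symm⟩, fun ⟨e⟩ ⟨f⟩ => ⟨e.trans f⟩⟩

/-- Isomorphism classes of finite-dimensional complex representations of `G`. -/
def IsoClass (G : Type*) [Group G] : Type _ := Quotient (matRepSetoid G)

namespace IsoClass

variable {G H : Type*} [Group G] [Group H]

section

variable {V V' V'' : Type*}
  [AddCommGroup V] [Module ℂ V] [Module.Finite ℂ V]
  [AddCommGroup V'] [Module ℂ V'] [Module.Finite ℂ V']
  [AddCommGroup V''] [Module ℂ V''] [Module.Finite ℂ V'']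

/-- The representation on `ℂⁿ`, `n = dim V`, obtained from `ρ` by choosing a basis of `V`. -/
def toMatRep (ρ : Representation ℂ G V) : MatRep G :=
  ⟨Module.finrank ℂ V,
    { toFun := fun g => (Module.finBasis ℂ V).equivFun.conj (ρ g)
      map_one' := by rw [map_one]; exact LinearEquiv.conj_id _
      map_mul' := fun g h => by
        rw [map_mul]; exact LinearEquiv.conj_comp _ _ _ }⟩

/-- A representation is isomorphic to its version on `ℂⁿ`. -/
def toMatRepEquiv (ρ : Representation ℂ G V) : ρ.Equiv (toMatRep ρ).2 :=
  Representation.Equiv.mk (Module.finBasis ℂ V).equivFun fun g => by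
    apply LinearMap.ext
    intro v
    change _ = (Module.finBasis ℂ V).equivFun.conj (ρ g) ((Module.finBasis ℂ V).equivFun v)
    rw [LinearEquiv.conj_apply_apply, LinearEquiv.symm_apply_apply]
    rfl

/-- The isomorphism class of a finite-dimensional complex representation. -/
def mk (ρ : Representation ℂ G V) : IsoClass G := Quotient.mk (matRepSetoid G) (toMatRep ρ)

theorem mk_eq_mk {ρ : Representation ℂ G V} {σ : Representation ℂ G V'} (e : ρ.Equiv σ) :
    mk ρ = mk σ :=
  Quotient.sound ⟨((toMatRepEquiv ρ).symm.trans e).trans (toMatRepEquiv σ)⟩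

theorem mk_eq_mk_iff {ρ : Representation ℂ G V} {σ : Representation ℂ G V'} :
    mk ρ = mk σ ↔ Nonempty (ρ.Equiv σ) :=
  ⟨fun h => (Quotient.exact h).elim fun e =>
    ⟨((toMatRepEquiv ρ).trans e).trans (toMatRepEquiv σ).symm⟩, fun ⟨e⟩ => mk_eq_mk e⟩

end

theorem mk_matRep (a : MatRep G) : mk a.2 = Quotient.mk (matRepSetoid G) a :=
  Quotient.sound ⟨(toMatRepEquiv a.2).symm⟩

theorem exists_rep (c : IsoClass G) :
    ∃ (n : ℕ) (ρ : Representation ℂ G (Fin n → ℂ)), mk ρ = c :=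
  Quotient.inductionOn c fun a => ⟨a.1, a.2, mk_matRep a⟩

/-- An isomorphism-invariant function of representations on the spaces `ℂⁿ` descends to
isomorphism classes. -/
def lift {β : Type*} (f : MatRep G → β) (hf : ∀ a b, a.2.Equiv b.2 → f a = f b) :
    IsoClass G → β :=
  Quotient.lift f fun a b ⟨e⟩ => hf a b e

section

variable {U V U' V' : Type*}
  [AddCommGroup U] [Module ℂ U] [AddCommGroup V] [Module ℂ V]
  [AddCommGroup U'] [Module ℂ U'] [AddCommGroup V'] [Module ℂ V']

/-- Direct sums of isomorphic representations are isomorphic. -/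
def prodCongr {ρ : Representation ℂ G U} {ρ' : Representation ℂ G U'}
    {σ : Representation ℂ G V} {σ' : Representation ℂ G V'}
    (e : ρ.Equiv ρ') (f : σ.Equiv σ') : (ρ.prod σ).Equiv (ρ'.prod σ') :=
  Representation.Equiv.mk (e.toLinearEquiv.prodCongr f.toLinearEquiv) fun g => by
    apply LinearMap.ext
    rintro ⟨u, v⟩
    exact Prod.ext (e.toIntertwiningMap.isIntertwining _ _ g u)
      (f.toIntertwiningMap.isIntertwining _ _ g v)

/-- Tensor products of isomorphic representations are isomorphic. -/
def tprodCongr {ρ : Representation ℂ G U} {ρ' : Representation ℂ G U'}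
    {σ : Representation ℂ G V} {σ' : Representation ℂ G V'}
    (e : ρ.Equiv ρ') (f : σ.Equiv σ') : (ρ.tprod σ).Equiv (ρ'.tprod σ') :=
  Representation.Equiv.mk (TensorProduct.congr e.toLinearEquiv f.toLinearEquiv) fun g => by
    apply TensorProduct.ext'
    intro u v
    exact congrArg₂ (TensorProduct.tmul ℂ) (e.toIntertwiningMap.isIntertwining _ _ g u)
      (f.toIntertwiningMap.isIntertwining _ _ g v)

end

/-- Direct sum of isomorphism classes. -/
instance : Add (IsoClass G) where
  add := Quotient.map₂ (fun a b => toMatRep (a.2.prod b.2)) fun _ _ ⟨e⟩ _ _ ⟨f⟩ =>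
    ⟨((toMatRepEquiv _).symm.trans (prodCongr e f)).trans (toMatRepEquiv _)⟩

/-- Tensor product of isomorphism classes. -/
instance : Mul (IsoClass G) where
  mul := Quotient.map₂ (fun a b => toMatRep (a.2.tprod b.2)) fun _ _ ⟨e⟩ _ _ ⟨f⟩ =>
    ⟨((toMatRepEquiv _).symm.trans (tprodCongr e f)).trans (toMatRepEquiv _)⟩

/-- The class of the one-dimensional trivial representation. -/
instance : One (IsoClass G) where
  one := mk (Representation.trivial ℂ G ℂ)

theorem one_def : (1 : IsoClass G) = mk (Representation.trivial ℂ G ℂ) := rfl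

section

variable {U V V' : Type*}
  [AddCommGroup U] [Module ℂ U] [Module.Finite ℂ U]
  [AddCommGroup V] [Module ℂ V] [Module.Finite ℂ V]
  [AddCommGroup V'] [Module ℂ V'] [Module.Finite ℂ V']

theorem mk_add_mk (ρ : Representation ℂ G U) (σ : Representation ℂ G V) :
    mk ρ + mk σ = mk (ρ.prod σ) :=
  Quotient.sound ⟨((toMatRepEquiv _).symm.trans
    (prodCongr (toMatRepEquiv ρ).symm (toMatRepEquiv σ).symm)).trans (toMatRepEquiv _)⟩

theorem mk_mul_mk (ρ : Representation ℂ G U) (σ : Representation ℂ G V) :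
    mk ρ * mk σ = mk (ρ.tprod σ) :=
  Quotient.sound ⟨((toMatRepEquiv _).symm.trans
    (tprodCongr (toMatRepEquiv ρ).symm (toMatRepEquiv σ).symm)).trans (toMatRepEquiv _)⟩

end

instance : CommMonoid (IsoClass G) where
  mul_assoc a b c := by
    obtain ⟨_, ρ, rfl⟩ := exists_rep a
    obtain ⟨_, σ, rfl⟩ := exists_rep b
    obtain ⟨_, τ, rfl⟩ := exists_rep c
    simp only [mk_mul_mk]
    exact mk_eq_mk (Representation.Equiv.mk (TensorProduct.assoc ℂ _ _ _) fun g => by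
      apply TensorProduct.ext_threefold
      intro x y z
      simp)
  one_mul a := by
    obtain ⟨_, ρ, rfl⟩ := exists_rep a
    rw [one_def, mk_mul_mk]
    exact mk_eq_mk (Representation.Equiv.mk (TensorProduct.lid ℂ _) fun g => by
      apply TensorProduct.ext'
      intro x y
      simp)
  mul_one a := by
    obtain ⟨_, ρ, rfl⟩ := exists_rep a
    rw [one_def, mk_mul_mk]
    exact mk_eq_mk (Representation.Equiv.mk (TensorProduct.rid ℂ _) fun g => by
      apply TensorProduct.ext'
      intro x y
      simp)
  mul_comm a b := by
    obtain ⟨_, ρ, rfl⟩ := exists_rep a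
    obtain ⟨_, σ, rfl⟩ := exists_rep b
    simp only [mk_mul_mk]
    exact mk_eq_mk (Representation.Equiv.mk (TensorProduct.comm ℂ _ _) fun g => by
      apply TensorProduct.ext'
      intro x y
      simp)

theorem mul_add_class (a b c : IsoClass G) : a * (b + c) = a * b + a * c := by
  obtain ⟨_, ρ, rfl⟩ := exists_rep a
  obtain ⟨_, σ, rfl⟩ := exists_rep b
  obtain ⟨_, τ, rfl⟩ := exists_rep c
  simp only [mk_mul_mk, mk_add_mk]
  exact mk_eq_mk (Representation.Equiv.mk (TensorProduct.prodRight ℂ ℂ _ _ _) fun g => by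
    apply TensorProduct.ext'
    rintro x ⟨y, z⟩
    simp)

/-- Pullback of representations along a group homomorphism. -/
def pullback (φ : H →* G) : IsoClass G →* IsoClass H where
  toFun := lift (fun a => mk (a.2.comp φ)) fun a b e =>
    mk_eq_mk (Representation.Equiv.mk e.toLinearEquiv fun h => e.toIntertwiningMap.2 (φ h))
  map_one' := by
    rw [one_def]
    exact mk_eq_mk (ρ := (toMatRep (Representation.trivial ℂ G ℂ)).2.comp φ)
      (σ := Representation.trivial ℂ H ℂ)
      (Representation.Equiv.mk (toMatRepEquiv (Representation.trivial ℂ G ℂ)).symm.toLinearEquiv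
        fun h => (toMatRepEquiv (Representation.trivial ℂ G ℂ)).symm.toIntertwiningMap.2 (φ h))
  map_mul' a b := by
    refine Quotient.inductionOn₂ a b fun x y => ?_
    change mk ((toMatRep (x.2.tprod y.2)).2.comp φ) = mk (x.2.comp φ) * mk (y.2.comp φ)
    rw [mk_mul_mk]
    exact mk_eq_mk
      (Representation.Equiv.mk (toMatRepEquiv (x.2.tprod y.2)).symm.toLinearEquiv
        fun h => (toMatRepEquiv (x.2.tprod y.2)).symm.toIntertwiningMap.2 (φ h))

theorem pullback_mk (φ : H →* G) {V : Type*} [AddCommGroup V] [Module ℂ V] [Module.Finite ℂ V]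
    (ρ : Representation ℂ G V) : pullback φ (mk ρ) = mk (ρ.comp φ) :=
  mk_eq_mk (ρ := (toMatRep ρ).2.comp φ)
    (Representation.Equiv.mk (toMatRepEquiv ρ).symm.toLinearEquiv
      fun h => (toMatRepEquiv ρ).symm.toIntertwiningMap.2 (φ h))

theorem pullback_add (φ : H →* G) (a b : IsoClass G) :
    pullback φ (a + b) = pullback φ a + pullback φ b := by
  obtain ⟨_, ρ, rfl⟩ := exists_rep a
  obtain ⟨_, σ, rfl⟩ := exists_rep b
  simp only [mk_add_mk, pullback_mk]
  rfl

/-- The value at `g` of the character of an isomorphism class. -/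
def char (g : G) : IsoClass G →* ℂ where
  toFun := lift (fun a => a.2.character g) fun a b e => congrFun (Representation.char_iso e) g
  map_one' := by
    change (toMatRep (Representation.trivial ℂ G ℂ)).2.character g = 1
    rw [← Representation.char_iso (toMatRepEquiv (Representation.trivial ℂ G ℂ))]
    have : Representation.trivial ℂ G ℂ g = 1 := rfl
    simp [Representation.character, this]
  map_mul' a b := by
    refine Quotient.inductionOn₂ a b fun x y => ?_
    change (toMatRep (x.2.tprod y.2)).2.character g = x.2.character g * y.2.character g
    rw [← Representation.char_iso (toMatRepEquiv (x.2.tprod y.2)), Representation.char_tensor]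
    rfl

theorem char_mk (g : G) {V : Type*} [AddCommGroup V] [Module ℂ V] [Module.Finite ℂ V]
    (ρ : Representation ℂ G V) : char g (mk ρ) = ρ.character g := by
  change (toMatRep ρ).2.character g = ρ.character g
  rw [← Representation.char_iso (toMatRepEquiv ρ)]

theorem char_add (g : G) (a b : IsoClass G) : char g (a + b) = char g a + char g b := by
  obtain ⟨_, ρ, rfl⟩ := exists_rep a
  obtain ⟨_, σ, rfl⟩ := exists_rep b
  simp only [mk_add_mk, char_mk]
  exact LinearMap.trace_prodMap' (ρ g) (σ g)

/-- Functoriality of induction. -/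
def indMap (φ : H →* G) {U V : Type*} [AddCommGroup U] [Module ℂ U] [AddCommGroup V] [Module ℂ V]
    {ρ : Representation ℂ H U} {σ : Representation ℂ H V} (f : ρ.IntertwiningMap σ) :
    Representation.IndV φ ρ →ₗ[ℂ] Representation.IndV φ σ :=
  Representation.Coinvariants.map _ _ ⟨f.toLinearMap.lTensor _, fun h => by
    apply TensorProduct.ext'
    intro x u
    simp [f.isIntertwining]⟩

theorem indMap_mk (φ : H →* G) {U V : Type*} [AddCommGroup U] [Module ℂ U]
    [AddCommGroup V] [Module ℂ V] {ρ : Representation ℂ H U} {σ : Representation ℂ H V}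
    (f : ρ.IntertwiningMap σ) (x : G) (u : U) :
    indMap φ f (Representation.IndV.mk φ ρ x u) = Representation.IndV.mk φ σ x (f u) := rfl

/-- Representations induced from isomorphic representations are isomorphic. -/
def indCongr (φ : H →* G) {U V : Type*} [AddCommGroup U] [Module ℂ U]
    [AddCommGroup V] [Module ℂ V] {ρ : Representation ℂ H U} {σ : Representation ℂ H V}
    (e : ρ.Equiv σ) : (ρ.ind φ).Equiv (σ.ind φ) :=
  Representation.Equiv.mk
    (LinearEquiv.ofLinearMap (indMap φ e.toIntertwiningMap) (indMap φ e.symm.toIntertwiningMap)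
      (by
        apply Representation.IndV.hom_ext
        intro x
        apply LinearMap.ext
        intro v
        change indMap φ _ (indMap φ _ (Representation.IndV.mk φ σ x v)) = _
        rw [indMap_mk, indMap_mk]
        simp)
      (by
        apply Representation.IndV.hom_ext
        intro x
        apply LinearMap.ext
        intro v
        change indMap φ _ (indMap φ _ (Representation.IndV.mk φ ρ x v)) = _
        rw [indMap_mk, indMap_mk]
        simp))
    fun g => by
      apply Representation.IndV.hom_ext
      intro x
      apply LinearMap.ext
      intro v
      change indMap φ _ (ρ.ind φ g (Representation.IndV.mk φ ρ x v)) =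
        σ.ind φ g (indMap φ _ (Representation.IndV.mk φ ρ x v))
      rw [Representation.ind_mk, indMap_mk, indMap_mk, Representation.ind_mk]

/-- Induction commutes with direct sums. -/
def indProd (φ : H →* G) {U V : Type*} [AddCommGroup U] [Module ℂ U]
    [AddCommGroup V] [Module ℂ V] (ρ : Representation ℂ H U) (σ : Representation ℂ H V) :
    ((ρ.prod σ).ind φ).Equiv ((ρ.ind φ).prod (σ.ind φ)) :=
  Representation.Equiv.mk
    (LinearEquiv.ofLinearMap
      ((indMap φ (Representation.IntertwiningMap.fst ℂ ρ σ)).prod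
        (indMap φ (Representation.IntertwiningMap.snd ℂ ρ σ)))
      ((indMap φ (Representation.IntertwiningMap.inl ℂ ρ σ)).coprod
        (indMap φ (Representation.IntertwiningMap.inr ℂ ρ σ)))
      (by
        apply LinearMap.prod_ext
        · apply Representation.IndV.hom_ext
          intro x
          apply LinearMap.ext
          intro v
          change (indMap φ _ (indMap φ _ (Representation.IndV.mk φ ρ x v)),
            indMap φ _ (indMap φ _ (Representation.IndV.mk φ ρ x v))) =
              (Representation.IndV.mk φ ρ x v, 0)
          simp only [indMap_mk]
          exact Prod.ext rfl (map_zero (Representation.IndV.mk φ σ x))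
        · apply Representation.IndV.hom_ext
          intro x
          apply LinearMap.ext
          intro v
          change (indMap φ _ (indMap φ _ (Representation.IndV.mk φ σ x v)),
            indMap φ _ (indMap φ _ (Representation.IndV.mk φ σ x v))) =
              (0, Representation.IndV.mk φ σ x v)
          simp only [indMap_mk]
          exact Prod.ext (map_zero (Representation.IndV.mk φ ρ x)) rfl)
      (by
        apply Representation.IndV.hom_ext
        intro x
        apply LinearMap.ext
        rintro ⟨u, v⟩
        change indMap φ _ (indMap φ _ (Representation.IndV.mk φ (ρ.prod σ) x (u, v))) +
          indMap φ _ (indMap φ _ (Representation.IndV.mk φ (ρ.prod σ) x (u, v))) =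
            Representation.IndV.mk φ (ρ.prod σ) x (u, v)
        simp only [indMap_mk]
        rw [← map_add]
        exact congrArg _ (Prod.ext (add_zero u) (zero_add v))))
    fun g => by
      apply Representation.IndV.hom_ext
      intro x
      apply LinearMap.ext
      intro v
      rfl

section Induction

variable [Finite G]

instance finite_indV (φ : H →* G) {V : Type*} [AddCommGroup V] [Module ℂ V] [Module.Finite ℂ V]
    (ρ : Representation ℂ H V) : Module.Finite ℂ (Representation.IndV φ ρ) := by
  have : Module.Finite ℂ (MonoidAlgebra ℂ G) :=
    Module.Finite.equiv (MonoidAlgebra.coeffLinearEquiv (S := ℂ) (R := ℂ) (M := G)).symm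
  infer_instance

/-- Induction of isomorphism classes of representations along a group homomorphism `φ : H → G`;
for the inclusion of a subgroup this is `V ↦ ℂ[G] ⊗_{ℂ[H]} V`. -/
def ind (φ : H →* G) : IsoClass H → IsoClass G :=
  lift (fun a => mk (a.2.ind φ)) fun _ _ e => mk_eq_mk (indCongr φ e)

theorem ind_mk (φ : H →* G) {V : Type*} [AddCommGroup V] [Module ℂ V] [Module.Finite ℂ V]
    (ρ : Representation ℂ H V) : ind φ (mk ρ) = mk (ρ.ind φ) :=
  mk_eq_mk (ρ := (toMatRep ρ).2.ind φ) (indCongr φ (toMatRepEquiv ρ).symm)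

theorem ind_add (φ : H →* G) (a b : IsoClass H) : ind φ (a + b) = ind φ a + ind φ b := by
  obtain ⟨_, ρ, rfl⟩ := exists_rep a
  obtain ⟨_, σ, rfl⟩ := exists_rep b
  simp only [mk_add_mk, ind_mk]
  exact mk_eq_mk (indProd φ ρ σ)

end Induction

end IsoClass

/-- The relations `[V ⊕ V'] = [V] + [V']`. As tensor products distribute over direct sums, the
ideal generated by them is the same as the additive subgroup generated by them. -/
def relIdeal (G : Type*) [Group G] : Ideal (FreeAbelianGroup (IsoClass G)) :=
  Ideal.span {x | ∃ a b : IsoClass G,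
    x = FreeAbelianGroup.of (a + b) - FreeAbelianGroup.of a - FreeAbelianGroup.of b}

/-- The complex representation ring `R(G)`: the free abelian group on the isomorphism classes of
finite-dimensional complex representations modulo `[V ⊕ V'] = [V] + [V']`, with the product
`[V] [V'] = [V ⊗ V']`. -/
def RepRing (G : Type*) [Group G] : Type _ := FreeAbelianGroup (IsoClass G) ⧸ relIdeal G

namespace RepRing

variable {G H : Type*} [Group G] [Group H]

instance : CommRing (RepRing G) :=
  inferInstanceAs (CommRing (FreeAbelianGroup (IsoClass G) ⧸ relIdeal G))

/-- The class of a finite-dimensional representation in the representation ring. -/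
def of (c : IsoClass G) : RepRing G := Ideal.Quotient.mk (relIdeal G) (FreeAbelianGroup.of c)

theorem of_add (a b : IsoClass G) : of (a + b) = of a + of b := by
  have h : FreeAbelianGroup.of (a + b) - FreeAbelianGroup.of a - FreeAbelianGroup.of b ∈
      relIdeal G := Ideal.subset_span ⟨a, b, rfl⟩
  have h' := Ideal.Quotient.eq_zero_iff_mem.2 h
  rw [map_sub, map_sub, sub_sub, sub_eq_zero] at h'
  exact h'

theorem relIdeal_toAddSubgroup : (relIdeal G).toAddSubgroup =
    AddSubgroup.closure {x | ∃ a b : IsoClass G,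
      x = FreeAbelianGroup.of (a + b) - FreeAbelianGroup.of a - FreeAbelianGroup.of b} := by
  apply le_antisymm
  · intro x hx
    refine Submodule.span_induction (p := fun x _ => x ∈ AddSubgroup.closure _)
      (fun x hx => AddSubgroup.subset_closure hx) (AddSubgroup.zero_mem _)
      (fun x y _ _ => AddSubgroup.add_mem _) (fun c x _ hx => ?_) hx
    rw [smul_eq_mul]
    refine AddSubgroup.closure_induction (p := fun x _ => c * x ∈ AddSubgroup.closure _)
      ?_ (by simp)
      (fun x y _ _ h h' => by rw [mul_add]; exact AddSubgroup.add_mem _ h h')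
      (fun x _ h => by rw [mul_neg]; exact AddSubgroup.neg_mem _ h) hx
    rintro _ ⟨a, b, rfl⟩
    induction c using FreeAbelianGroup.induction_on' with
    | zero => simp
    | pure z =>
      change FreeAbelianGroup.of z * _ ∈ _
      apply AddSubgroup.subset_closure
      refine ⟨z * a, z * b, ?_⟩
      rw [mul_sub, mul_sub, FreeAbelianGroup.of_mul_of, FreeAbelianGroup.of_mul_of,
        FreeAbelianGroup.of_mul_of, IsoClass.mul_add_class]
    | neg z h => rw [neg_mul]; exact AddSubgroup.neg_mem _ h
    | add x y h h' => rw [add_mul]; exact AddSubgroup.add_mem _ h h'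
  · rw [AddSubgroup.closure_le]
    exact Ideal.subset_span

/-- Ring homomorphisms out of the representation ring. -/
def liftRing {A : Type*} [CommRing A] (f : IsoClass G →* A)
    (hf : ∀ a b, f (a + b) = f a + f b) : RepRing G →+* A :=
  Ideal.Quotient.lift (relIdeal G) (FreeAbelianGroup.liftMonoid f) fun x hx => by
    rw [← RingHom.mem_ker]
    revert x
    change relIdeal G ≤ _
    refine Ideal.span_le.2 ?_
    rintro _ ⟨a, b, rfl⟩
    simp [hf]

/-- Additive maps out of the representation ring. -/
def liftAdd {A : Type*} [AddCommGroup A] (f : IsoClass G → A)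
    (hf : ∀ a b, f (a + b) = f a + f b) : RepRing G →+ A :=
  QuotientAddGroup.lift (relIdeal G).toAddSubgroup (FreeAbelianGroup.lift f) (by
    rw [relIdeal_toAddSubgroup, AddSubgroup.closure_le]
    rintro _ ⟨a, b, rfl⟩
    simp [hf])

/-- Pullback `Λ_φ : R(G) → R(H)` along a group homomorphism `φ : H → G`. For the inclusion of a
subgroup this is restriction. -/
def pullback (φ : H →* G) : RepRing G →+* RepRing H :=
  liftRing
    { toFun := fun a => of (IsoClass.pullback φ a)
      map_one' := by rw [map_one]; rfl
      map_mul' := fun a b => by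
        rw [map_mul, of, ← FreeAbelianGroup.of_mul_of, map_mul]; rfl }
    fun a b => by
      change of (IsoClass.pullback φ (a + b)) = _
      rw [IsoClass.pullback_add, of_add]; rfl

theorem pullback_of (φ : H →* G) (a : IsoClass G) :
    pullback φ (of a) = of (IsoClass.pullback φ a) :=
  FreeAbelianGroup.lift_apply_of (fun a => of (IsoClass.pullback φ a)) a

/-- Induction `R(H) → R(G)` along a group homomorphism `φ : H → G`. -/
def ind [Finite G] (φ : H →* G) : RepRing H →+ RepRing G :=
  liftAdd (fun a => of (IsoClass.ind φ a)) fun a b => by rw [IsoClass.ind_add, of_add]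

theorem ind_of [Finite G] (φ : H →* G) (a : IsoClass H) :
    ind φ (of a) = of (IsoClass.ind φ a) :=
  FreeAbelianGroup.lift_apply_of _ a

/-- Evaluation `ev_g : R(G) → ℂ` of characters at `g`. -/
def ev (g : G) : RepRing G →+* ℂ := liftRing (IsoClass.char g) (IsoClass.char_add g)

theorem ev_of (g : G) (a : IsoClass G) : ev g (of a) = IsoClass.char g a :=
  FreeAbelianGroup.lift_apply_of _ a

end RepRing

/-- The coefficientwise extension of an additive map to polynomials. -/
def mapCoeff {R S : Type*} [Semiring R] [Semiring S] (f : R →+ S) (p : R[X]) : S[X] :=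
  p.sum fun i a => monomial i (f a)

theorem coeff_mapCoeff {R S : Type*} [Semiring R] [Semiring S] (f : R →+ S) (p : R[X]) (i : ℕ) :
    (mapCoeff f p).coeff i = f (p.coeff i) := by
  simp only [mapCoeff, Polynomial.sum, finsetSum_coeff, coeff_monomial]
  rw [Finset.sum_ite_eq' p.support i]
  split_ifs with h
  · rfl
  · rw [notMem_support_iff.1 h, map_zero]

/-! ## Lower Eulerian posets -/

section Posets

/-- A function `ρ` is a rank function if it increases by one along covering relations. -/
def IsRankFunction {B : Type*} [PartialOrder B] (ρ : B → ℤ) : Prop :=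
  ∀ z z' : B, z ⋖ z' → ρ z' = ρ z + 1

/-- A (finite) poset is lower Eulerian with rank function `ρ` if it has a least element and
`∑ (-1) ^ ρ(z'') = 0`, summed over `z ≤ z'' ≤ z'`, for all `z < z'`. -/
structure IsLowerEulerianWith {B : Type*} [PartialOrder B] (ρ : B → ℤ) : Prop where
  rank : IsRankFunction ρ
  bot : ∃ b : B, IsBot b
  sum_eq_zero : ∀ z z' : B, z < z' →
    ∑ᶠ z'' ∈ Set.Icc z z', ((ρ z'').negOnePow : ℤ) = 0

/-- Lower Eulerian posets. -/
def IsLowerEulerian (B : Type*) [PartialOrder B] : Prop :=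
  ∃ ρ : B → ℤ, IsLowerEulerianWith ρ

/-- An element `q` is join-admissible if all joins `z ∨ q` exist. -/
def JoinAdmissible {B : Type*} [PartialOrder B] (q : B) : Prop :=
  ∀ z : B, ∃ s : B, IsLUB {z, q} s

/-- A triple `(Γ, ρ, q)`: a lower Eulerian poset with a rank function and a join-admissible element
that is not the least element. -/
structure IsTriple {Γ : Type*} [PartialOrder Γ] (ρ : Γ → ℤ) (q : Γ) : Prop where
  eulerian : IsLowerEulerianWith ρ
  join : JoinAdmissible q
  not_bot : ¬ IsBot q

variable {Γ : Type*} [PartialOrder Γ]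

/-- `X = {z ∈ Γ : q ≰ z}`. -/
def lowerPart (q : Γ) : Set Γ := {z | ¬ q ≤ z}

/-- `Y = {z ∈ Γ : q ≤ z}`. -/
def upperPart (q : Γ) : Set Γ := {z | q ≤ z}

/-- The map `σ : X → Y`, `σ(x) = x ∨ q`. -/
def sigma {q : Γ} (hq : JoinAdmissible q) (x : lowerPart q) : upperPart q :=
  ⟨(hq x).choose, (hq x).choose_spec.1 (by simp)⟩

/-- A weak rank function. Only the values `r z z'` with `z ≤ z'` are relevant. -/
structure IsWeakRank (r : Γ → Γ → ℕ) : Prop where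
  pos : ∀ z z', z < z' → 0 < r z z'
  add : ∀ z z'' z', z ≤ z'' → z'' ≤ z' → r z z' = r z z'' + r z'' z'

/-- `W`-invariance of a weak rank function. -/
def IsInvariantRank (W : Type*) [Group W] [MulAction W Γ] (r : Γ → Γ → ℕ) : Prop :=
  ∀ (w : W) (z z' : Γ), z ≤ z' → r (w • z) (w • z') = r z z'

/-- An Eulerian action of `W` on the triple `(Γ, ρ, q)`: `W` acts on the poset `Γ`, preserving `ρ`
and fixing `q`, and each fixed poset `Γ ^ w` is lower Eulerian. -/
structure IsEulerianAction (W : Type*) [Group W] [MulAction W Γ] (ρ : Γ → ℤ) (q : Γ) : Prop where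
  mono : ∀ (w : W) (z z' : Γ), z ≤ z' → w • z ≤ w • z'
  rank : ∀ (w : W) (z : Γ), ρ (w • z) = ρ z
  fix : ∀ w : W, w • q = q
  eulerian : ∀ w : W, IsLowerEulerian (MulAction.fixedBy Γ w)

end Posets

/-! ## The equivariant incidence algebra -/

section Incidence

variable (W : Type*) [Group W] {B : Type*} [MulAction W B]

/-- `W_{z,z'}`, the common stabilizer of `z` and `z'`. -/
def stab₂ (z z' : B) : Subgroup W := MulAction.stabilizer W z ⊓ MulAction.stabilizer W z'

/-- `W_{z,z'',z'}`, the common stabilizer of `z`, `z''` and `z'`. -/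
def stab₃ (z z'' z' : B) : Subgroup W :=
  MulAction.stabilizer W z ⊓ MulAction.stabilizer W z'' ⊓ MulAction.stabilizer W z'

theorem stab₃_le_left (z z'' z' : B) : stab₃ W z z'' z' ≤ stab₂ W z z'' :=
  inf_le_left

theorem stab₃_le_right (z z'' z' : B) : stab₃ W z z'' z' ≤ stab₂ W z'' z' :=
  le_inf (inf_le_left.trans inf_le_right) inf_le_right

theorem stab₃_le (z z'' z' : B) : stab₃ W z z'' z' ≤ stab₂ W z z' :=
  le_inf (inf_le_left.trans inf_le_left) inf_le_right

variable {W}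

/-- The map `W_{z,z'} → W_{w z, w z'}` given by conjugation by `w`. -/
def conjHom (w : W) (z z' : B) : stab₂ W z z' →* stab₂ W (w • z) (w • z') :=
  ((MulAut.conj w).toMonoidHom.comp (stab₂ W z z').subtype).codRestrict _ fun g => by
    have h₁ : (g : W) • z = z := g.2.1
    have h₂ : (g : W) • z' = z' := g.2.2
    constructor
    · change (w * (g : W) * w⁻¹) • w • z = w • z
      rw [← mul_smul, inv_mul_cancel_right, mul_smul, h₁]
    · change (w * (g : W) * w⁻¹) • w • z' = w • z'
      rw [← mul_smul, inv_mul_cancel_right, mul_smul, h₂]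

variable [PartialOrder B]

variable (W B) in
/-- Families of polynomials `p(z, z') ∈ R(W_{z,z'})[t]`, indexed by the pairs `z ≤ z'`. The
equivariant incidence algebra `I^W(B)` consists of those satisfying `IsEquivariant` below. -/
def IncFun : Type _ := ∀ z z' : B, z ≤ z' → (RepRing (stab₂ W z z'))[X]

/-- The condition `p(z, z') = Λ_w (p(w z, w z'))`, where `Λ_w` is pullback along conjugation by `w`,
that defines the equivariant incidence algebra `I^W(B)`. -/
def IsEquivariant (p : IncFun W B) : Prop :=
  ∀ (w : W) (z z' : B) (h : z ≤ z') (h' : w • z ≤ w • z'),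
    p z z' h = (p (w • z) (w • z') h').map (RepRing.pullback (conjHom w z z'))

namespace IncFun

@[ext] theorem ext {p p' : IncFun W B} (h : ∀ z z' hz, p z z' hz = p' z z' hz) : p = p' :=
  funext fun z => funext fun z' => funext fun hz => h z z' hz

instance : Zero (IncFun W B) where
  zero := fun _ _ _ => 0

instance : Add (IncFun W B) where
  add p p' := fun z z' h => p z z' h + p' z z' h

instance : Neg (IncFun W B) where
  neg p := fun z z' h => -p z z' h

/-- Scalar multiplication by `ℤ[t]`. -/
instance : SMul ℤ[X] (IncFun W B) where
  smul a p := fun z z' h => a.map (Int.castRingHom _) * p z z' h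

open Classical in
/-- The identity element `δ`. -/
instance : One (IncFun W B) where
  one := fun z z' _ => if z = z' then 1 else 0

variable [Finite W]

/-- The contribution `Ind (Res p(z, z'') · Res p'(z'', z'))` of `z''` to `(p · p')(z, z')`. -/
def mulTerm (p p' : IncFun W B) (z z'' z' : B) (h : z ≤ z'') (h' : z'' ≤ z') :
    (RepRing (stab₂ W z z'))[X] :=
  mapCoeff (RepRing.ind (Subgroup.inclusion (stab₃_le W z z'' z')))
    ((p z z'' h).map (RepRing.pullback (Subgroup.inclusion (stab₃_le_left W z z'' z'))) *
      (p' z'' z' h').map (RepRing.pullback (Subgroup.inclusion (stab₃_le_right W z z'' z'))))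

open Classical in
/-- The product of the equivariant incidence algebra. The group `W_{z,z'}` acts on the interval
`[z, z']`, and `(p · p')(z, z')` is the sum of `Ind (Res p(z, z'') · Res p'(z'', z'))` over
representatives `z''` of the orbits of this action. For equivariant `p` and `p'` the summand depends
only on the orbit, which has `|W_{z,z'}| / |W_{z,z'',z'}|` elements, so this is the sum over all
`z ≤ z'' ≤ z'` of `|W_{z,z'',z'}| / |W_{z,z'}|` times this expression. -/
instance : Mul (IncFun W B) where
  mul p p' := fun z z' _ =>
    ∑ᶠ o : MulAction.orbitRel.Quotient (stab₂ W z z') B,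
      if h : z ≤ o.out ∧ o.out ≤ z' then mulTerm p p' z o.out z' h.1 h.2 else 0

end IncFun

/-- The unique element with the property `P` (and `0` if there is no such unique element). -/
def the {α : Type*} [Zero α] (P : α → Prop) : α :=
  open Classical in if h : ∃! x, P x then h.choose else 0

theorem the_spec {α : Type*} [Zero α] {P : α → Prop} (h : ∃! x, P x) : P (the P) := by
  rw [the, dif_pos h]
  exact h.choose_spec.1

/-- The subring of elements `p` of `I^W(B)` with `deg p(z, z') ≤ r(z, z')`. -/
def II (r : B → B → ℕ) : Set (IncFun W B) :=
  {p | IsEquivariant p ∧ ∀ (z z' : B) (h : z ≤ z'), (p z z' h).natDegree ≤ r z z'}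

/-- The subring of elements `p` of `II r` with `deg p(z, z') < r(z, z') / 2` for `z < z'`. As
`0 < r(z, z')` in this case, the zero polynomial satisfies the condition. -/
def IIHalf (r : B → B → ℕ) : Set (IncFun W B) :=
  {p | p ∈ II r ∧ ∀ (z z' : B) (h : z < z'), 2 * (p z z' h.le).natDegree < r z z'}

variable (W B) in
/-- The elements `p` of `I^W(B)` with `p(z, z) = 1` for all `z`. -/
def UU : Set (IncFun W B) := {p | IsEquivariant p ∧ ∀ z : B, p z z le_rfl = 1}

/-- `p^rev(z, z'; t) = t ^ r(z, z') p(z, z'; t⁻¹)`, for `p ∈ II r`. -/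
def rev (r : B → B → ℕ) (p : IncFun W B) : IncFun W B :=
  fun z z' h => (p z z' h).reflect (r z z')

open Classical in
/-- The operator `Δ`: for `z < z'` the polynomial `(Δ p)(z, z')` is the truncation of
`(1 - t) p(z, z')` to degrees less than `r(z, z') / 2`, and `(Δ p)(z, z) = 0`. -/
def Delta (r : B → B → ℕ) (p : IncFun W B) : IncFun W B :=
  fun z z' h =>
    if z = z' then 0
    else C ((p z z' h).coeff 0) + ∑ i ∈ Finset.Icc 1 ((r z z' - 1) / 2),
      monomial i ((p z z' h).coeff i - (p z z' h).coeff (i - 1))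

open Classical in
/-- The element `p|_S`, for a set `S` of intervals. -/
def restrict (S : B → B → Prop) (p : IncFun W B) : IncFun W B :=
  fun z z' h => if S z z' then p z z' h else 0

/-- `p|_X`. -/
def restrictX (q : B) (p : IncFun W B) : IncFun W B :=
  restrict (fun z z' => z ∈ lowerPart q ∧ z' ∈ lowerPart q) p

/-- `p|_Y`. -/
def restrictY (q : B) (p : IncFun W B) : IncFun W B :=
  restrict (fun z z' => z ∈ upperPart q ∧ z' ∈ upperPart q) p

/-- `p|_{X/Y}`. -/
def restrictXY (q : B) (p : IncFun W B) : IncFun W B :=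
  restrict (fun z z' => z ∈ lowerPart q ∧ z' ∈ upperPart q) p

/-- `p|_{(X/Y)°}`, supported on the intervals `[x, σ(x)]`. -/
def restrictXYo {q : B} (hq : JoinAdmissible q) (p : IncFun W B) : IncFun W B :=
  restrict (fun z z' => ∃ hz : z ∈ lowerPart q, z' = sigma hq ⟨z, hz⟩) p

/-- Evaluation at `w` of the characters occurring in the coefficients of `p(z, z')`, for elements
`z ≤ z'` fixed by `w`. -/
def evAt (p : IncFun W B) (w : W) (z z' : B) (h : z ≤ z') (hz : w • z = z) (hz' : w • z' = z') :
    ℂ[X] :=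
  (p z z' h).map (RepRing.ev (⟨w, hz, hz'⟩ : stab₂ W z z'))

/-- `p` is multiplicative:
`ev_w(p(z, z')) = ev_w(p(z, z'')) ev_w(p(z'', z'))` for all `w` and all `z ≤ z'' ≤ z'` in `B ^ w`. -/
def IsMultiplicative (p : IncFun W B) : Prop :=
  ∀ (w : W) (z z'' z' : B) (h : z ≤ z'') (h' : z'' ≤ z')
    (hz : w • z = z) (hz'' : w • z'' = z'') (hz' : w • z' = z'),
    evAt p w z z' (h.trans h') hz hz' = evAt p w z z'' h hz hz'' * evAt p w z'' z' h' hz'' hz'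

/-- `p'` equals `p̂`: for all `w` and all `z ≤ z'` in `B ^ w`,
`ev_w(p'(z, z')) = (-1) ^ (ρ_w(z') - ρ_w(z)) ev_w(p(z, z'))`, where `ρ_w` is a rank function of the
lower Eulerian poset `B ^ w` (two rank functions differ by a constant). -/
def IsHat (p p' : IncFun W B) : Prop :=
  ∀ (w : W) (ρ : MulAction.fixedBy B w → ℤ), IsRankFunction ρ →
    ∀ (z z' : MulAction.fixedBy B w) (h : (z : B) ≤ z'),
      evAt p' w z z' h z.2 z'.2 = C ((-1 : ℂ) ^ (ρ z' - ρ z)) * evAt p w z z' h z.2 z'.2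

/-- `p̂`, for elements `p` of `II r` such that `p̂` has coefficients in the representation rings and
not only in their complexifications. -/
def hat (r : B → B → ℕ) (p : IncFun W B) : IncFun W B :=
  the fun p' => p' ∈ II r ∧ IsHat p p'

/-- `p` is rank alternating: `p^rev = p̂`. -/
def IsRankAlternating (r : B → B → ℕ) (p : IncFun W B) : Prop := IsHat p (rev r p)

variable [Finite W]

/-- `p'` is a two-sided inverse of `p` in `I^W(B)`. -/
def IsInverse (p p' : IncFun W B) : Prop := IsEquivariant p' ∧ p * p' = 1 ∧ p' * p = 1

/-- `p⁻¹`. -/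
def inverse (p : IncFun W B) : IncFun W B := the (IsInverse p)

/-- `κ` is an equivariant `B`-kernel. -/
def IsKernel (r : B → B → ℕ) (κ : IncFun W B) : Prop :=
  κ ∈ II r ∧ κ ∈ UU W B ∧ IsInverse κ (rev r κ)

/-- `f` is the right equivariant Kazhdan-Lusztig-Stanley function of the kernel `κ`. -/
def IsRightKLS (r : B → B → ℕ) (κ f : IncFun W B) : Prop :=
  f ∈ IIHalf r ∧ f ∈ UU W B ∧ rev r f = κ * f

/-- `g` is the left equivariant Kazhdan-Lusztig-Stanley function of the kernel `κ`. -/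
def IsLeftKLS (r : B → B → ℕ) (κ g : IncFun W B) : Prop :=
  g ∈ IIHalf r ∧ g ∈ UU W B ∧ rev r g = g * κ

/-- The right equivariant Kazhdan-Lusztig-Stanley function. -/
def rightKLS (r : B → B → ℕ) (κ : IncFun W B) : IncFun W B := the (IsRightKLS r κ)

/-- The left equivariant Kazhdan-Lusztig-Stanley function. -/
def leftKLS (r : B → B → ℕ) (κ : IncFun W B) : IncFun W B := the (IsLeftKLS r κ)

/-- The equivariant `Z`-function `Z = g · κ · f`. -/
def zFun (r : B → B → ℕ) (κ : IncFun W B) : IncFun W B := leftKLS r κ * κ * rightKLS r κ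

/-- `h` is the element `h_σ` of `II r`: it satisfies `(t - 1) h = g · κ|_{(X/Y)°}`. -/
def IsHPoly (r : B → B → ℕ) (κ : IncFun W B) {q : B} (hq : JoinAdmissible q) (h : IncFun W B) :
    Prop :=
  h ∈ II r ∧ ((X - 1 : ℤ[X])) • h = leftKLS r κ * restrictXYo hq κ

/-- The equivariant `h`-polynomials `h_σ`. -/
def hPoly (r : B → B → ℕ) (κ : IncFun W B) {q : B} (hq : JoinAdmissible q) : IncFun W B :=
  the (IsHPoly r κ hq)

/-- The equivariant local `h`-polynomials `ℓ_σ = h_σ · g⁻¹`. -/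
def localH (r : B → B → ℕ) (κ : IncFun W B) {q : B} (hq : JoinAdmissible q) : IncFun W B :=
  hPoly r κ hq * inverse (leftKLS r κ)

end Incidence

end

end EquivKLS

open EquivKLS

namespace EquivKLS

noncomputable section

section CharacterTheory

open Representation

universe u v

variable {G : Type*} [Group G]

/-- A representation is the direct sum of two complementary subrepresentations. -/
def prodEquivOfIsCompl {V : Type*} [AddCommGroup V] [Module ℂ V] {ρ : Representation ℂ G V}
    (S T : Subrepresentation ρ) (h : IsCompl S T) :
    (S.toRepresentation.prod T.toRepresentation).Equiv ρ :=
  have h' : IsCompl S.toSubmodule T.toSubmodule := by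
    constructor
    · rw [disjoint_iff, ← Subrepresentation.toSubmodule_inf, h.inf_eq_bot]; rfl
    · rw [codisjoint_iff, ← Subrepresentation.toSubmodule_sup, h.sup_eq_top]; rfl
  Representation.Equiv.mk (Submodule.prodEquivOfIsCompl _ _ h') fun g => by
    apply LinearMap.ext
    rintro ⟨x, y⟩
    change ((ρ g x : V) + (ρ g y : V)) = ρ g ((x : V) + y)
    rw [map_add]

theorem character_prod {V V' : Type*} [AddCommGroup V] [Module ℂ V] [Module.Finite ℂ V]
    [AddCommGroup V'] [Module ℂ V'] [Module.Finite ℂ V']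
    (ρ : Representation ℂ G V) (σ : Representation ℂ G V') (g : G) :
    (ρ.prod σ).character g = ρ.character g + σ.character g :=
  LinearMap.trace_prodMap' (ρ g) (σ g)

/-- The coimage of an intertwining map, realized as a complement of the kernel, is isomorphic to
the range. -/
def complKerEquivRange {V V' : Type*} [AddCommGroup V] [Module ℂ V]
    [AddCommGroup V'] [Module ℂ V']
    {ρ : Representation ℂ G V} {σ : Representation ℂ G V'} (f : ρ.IntertwiningMap σ)
    (T : Subrepresentation ρ) (h : IsCompl f.ker T) :
    T.toRepresentation.Equiv f.range.toRepresentation :=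
  have hinj : Function.Injective ((f.toLinearMap.domRestrict T.toSubmodule).codRestrict
      f.range.toSubmodule fun x => ⟨x, rfl⟩) := by
    rw [injective_iff_map_eq_zero]
    intro x hx
    have h₁ : (x : V) ∈ (f.ker ⊓ T).toSubmodule := ⟨congrArg Subtype.val hx, x.2⟩
    rw [h.inf_eq_bot] at h₁
    exact Subtype.ext h₁
  have hsurj : Function.Surjective ((f.toLinearMap.domRestrict T.toSubmodule).codRestrict
      f.range.toSubmodule fun x => ⟨x, rfl⟩) := by
    rintro ⟨_, x, rfl⟩
    have h₁ : x ∈ (f.ker ⊔ T).toSubmodule := by rw [h.sup_eq_top]; trivial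
    obtain ⟨y, hy, z, hz, rfl⟩ := Submodule.mem_sup.1 h₁
    refine ⟨⟨z, hz⟩, Subtype.ext ?_⟩
    change f z = f (y + z)
    have hy' : f y = 0 := hy
    rw [map_add, hy', zero_add]
  Representation.Equiv.mk (LinearEquiv.ofBijective _ ⟨hinj, hsurj⟩) fun g => by
    apply LinearMap.ext
    intro x
    exact Subtype.ext (f.isIntertwining _ _ g x)

/-- Complex representations of a finite group are determined by their characters. -/
theorem nonempty_equiv_of_character_eq [Finite G] {V : Type u} {V' : Type v}
    [AddCommGroup V] [Module ℂ V] [Module.Finite ℂ V]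
    [AddCommGroup V'] [Module ℂ V'] [Module.Finite ℂ V']
    (ρ : Representation ℂ G V) (σ : Representation ℂ G V') (h : ρ.character = σ.character) :
    Nonempty (ρ.Equiv σ) := by
  cases nonempty_fintype G
  have hcard : (Nat.card G : ℂ) ≠ 0 := Nat.cast_ne_zero.2 Nat.card_pos.ne'
  let _ : Invertible (Nat.card G : ℂ) := invertibleOfNonzero hcard
  induction hn : Module.finrank ℂ V using Nat.strong_induction_on generalizing V V' with
  | _ n ih =>
  have hdim : Module.finrank ℂ V = Module.finrank ℂ V' := by
    have := congrFun h 1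
    rw [Representation.char_one, Representation.char_one] at this
    exact_mod_cast this
  rcases Nat.eq_zero_or_pos n with h0 | hpos
  · have h₁ : Subsingleton V := Module.finrank_zero_iff.1 (hn.trans h0)
    have h₂ : Subsingleton V' := Module.finrank_zero_iff.1 (hdim.symm.trans (hn.trans h0))
    exact ⟨Representation.Equiv.mk (LinearEquiv.ofLinearMap 0 0 (Subsingleton.elim _ _)
      (Subsingleton.elim _ _)) fun g => LinearMap.ext fun x => Subsingleton.elim _ _⟩
  · have hV : Nontrivial V := Module.nontrivial_of_finrank_pos (R := ℂ) (by omega)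
    have hhom : Module.finrank ℂ (IntertwiningMap ρ σ) = Module.finrank ℂ (IntertwiningMap ρ ρ) := by
      have h₁ := card_inv_mul_sum_char_mul_char_eq_finrank ρ σ
      have h₂ := card_inv_mul_sum_char_mul_char_eq_finrank ρ ρ
      rw [← h, h₂] at h₁
      exact_mod_cast h₁.symm
    have hfin : Module.Finite ℂ (IntertwiningMap ρ ρ) :=
      Module.Finite.equiv (invariantsEquivIntertwiningMap ρ ρ)
    have hnt : Nontrivial (IntertwiningMap ρ ρ) := by
      obtain ⟨x, hx⟩ := exists_ne (0 : V)
      exact ⟨IntertwiningMap.id ρ, 0, fun h => hx (congrArg (fun f => f x) h)⟩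
    have hpos' : 0 < Module.finrank ℂ (IntertwiningMap ρ σ) :=
      hhom ▸ Module.finrank_pos
    have hnt' : Nontrivial (IntertwiningMap ρ σ) := Module.nontrivial_of_finrank_pos hpos'
    obtain ⟨f, hf⟩ := exists_ne (0 : IntertwiningMap ρ σ)
    obtain ⟨T, hT⟩ := exists_isCompl f.ker
    obtain ⟨C, hC⟩ := exists_isCompl f.range
    have e := complKerEquivRange f T hT
    have eV := prodEquivOfIsCompl _ _ hT
    have eV' := prodEquivOfIsCompl _ _ hC
    have hchar : f.ker.toRepresentation.character = C.toRepresentation.character := by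
      ext g
      have h₁ := congrFun h g
      rw [← char_iso eV, ← char_iso eV', character_prod, character_prod, char_iso e,
        add_comm] at h₁
      exact add_left_cancel h₁
    have hlt : Module.finrank ℂ f.ker.toSubmodule < n := by
      rw [← hn]
      refine Submodule.finrank_lt fun htop => hf ?_
      ext x
      have : x ∈ f.ker.toSubmodule := htop ▸ Submodule.mem_top
      exact this
    obtain ⟨e'⟩ := ih _ hlt f.ker.toRepresentation C.toRepresentation hchar rfl
    have ecomm : (C.toRepresentation.prod f.range.toRepresentation).Equiv
        (f.range.toRepresentation.prod C.toRepresentation) :=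
      Representation.Equiv.mk (LinearEquiv.prodComm ℂ _ _) fun g => rfl
    exact ⟨((eV.symm.trans (IsoClass.prodCongr e' e)).trans ecomm).trans eV'⟩

end CharacterTheory

namespace RepRing

variable {G H : Type*} [Group G] [Group H]

theorem exists_eq_of_sub_of (x : RepRing G) : ∃ a b : IsoClass G, x = of a - of b := by
  obtain ⟨y, rfl⟩ := Ideal.Quotient.mk_surjective x
  let z : IsoClass G := IsoClass.mk (Representation.trivial ℂ G (Fin 0 → ℂ))
  induction y using FreeAbelianGroup.induction_on with
  | zero => exact ⟨z, z, by rw [map_zero, sub_self]; rfl⟩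
  | of a => exact ⟨a + z, z, by rw [of_add, add_sub_cancel_right]; rfl⟩
  | neg a => exact ⟨z, a + z, by rw [of_add, map_neg, sub_add_cancel_right]; rfl⟩
  | add y y' h h' =>
    obtain ⟨a, b, h⟩ := h
    obtain ⟨a', b', h'⟩ := h'
    exact ⟨a + a', b + b', by rw [map_add, h, h', of_add, of_add]; abel⟩

/-- Elements of the representation ring are determined by their characters. -/
theorem ext_ev [Finite G] {x y : RepRing G} (h : ∀ g, ev g x = ev g y) : x = y := by
  obtain ⟨a, b, hab⟩ := exists_eq_of_sub_of (x - y)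
  rw [← sub_eq_zero, hab, sub_eq_zero]
  have key : a = b := by
    have h' : ∀ g, IsoClass.char g a = IsoClass.char g b := fun g => by
      rw [← ev_of, ← ev_of, ← sub_eq_zero, ← map_sub, ← hab, map_sub, h, sub_self]
    obtain ⟨_, ρ, rfl⟩ := IsoClass.exists_rep a
    obtain ⟨_, σ, rfl⟩ := IsoClass.exists_rep b
    obtain ⟨e⟩ := nonempty_equiv_of_character_eq ρ σ (funext fun g => by
      simpa only [IsoClass.char_mk] using h' g)
    exact IsoClass.mk_eq_mk e
  rw [key]

theorem ev_pullback (φ : H →* G) (h : H) (x : RepRing G) : ev h (pullback φ x) = ev (φ h) x := by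
  obtain ⟨a, b, rfl⟩ := exists_eq_of_sub_of x
  have key : ∀ a : IsoClass G, ev h (pullback φ (of a)) = ev (φ h) (of a) := fun a => by
    obtain ⟨_, ρ, rfl⟩ := IsoClass.exists_rep a
    rw [pullback_of, ev_of, ev_of, IsoClass.pullback_mk, IsoClass.char_mk, IsoClass.char_mk]
    rfl
  rw [map_sub, map_sub, map_sub, key, key]

end RepRing

section InducedCharacter

open Representation

/-- The trace of a linear map induced on coinvariants. -/
theorem trace_coinvariants_map {H : Type*} [Group H] [Fintype H] {V : Type*} [AddCommGroup V]
    [Module ℂ V] [Module.Finite ℂ V] (τ : Representation ℂ H V) (f : τ.IntertwiningMap τ) :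
    LinearMap.trace ℂ _ (Coinvariants.map τ τ f) =
      (Fintype.card H : ℂ)⁻¹ * ∑ h, LinearMap.trace ℂ V (τ h ∘ₗ f.toLinearMap) := by
  have hcard : (Fintype.card H : ℂ) ≠ 0 := Nat.cast_ne_zero.2 Fintype.card_ne_zero
  let avg : V →ₗ[ℂ] V := (Fintype.card H : ℂ)⁻¹ • ∑ h, τ h
  have havg : ∀ x, avg ∘ₗ τ x = avg := fun x => by
    rw [LinearMap.smul_comp, ← Module.End.mul_eq_comp, Finset.sum_mul]
    congr 1
    exact Fintype.sum_equiv (Equiv.mulRight x) _ _ fun h => (map_mul τ h x).symm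
  let s := Coinvariants.lift τ avg havg
  have hs : Coinvariants.mk τ ∘ₗ s = LinearMap.id := by
    apply Coinvariants.hom_ext
    ext v
    change Coinvariants.mk τ (avg v) = Coinvariants.mk τ v
    simp only [avg, LinearMap.smul_apply, LinearMap.sum_apply, map_smul, map_sum,
      Coinvariants.mk_self_apply, Finset.sum_const, Finset.card_univ]
    rw [← Nat.cast_smul_eq_nsmul ℂ, smul_smul, inv_mul_cancel₀ hcard, one_smul]
  calc LinearMap.trace ℂ _ (Coinvariants.map τ τ f)
      = LinearMap.trace ℂ _ (Coinvariants.map τ τ f ∘ₗ Coinvariants.mk τ ∘ₗ s) := by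
        rw [hs, LinearMap.comp_id]
    _ = LinearMap.trace ℂ _ ((Coinvariants.mk τ ∘ₗ f.toLinearMap) ∘ₗ s) := rfl
    _ = LinearMap.trace ℂ _ (s ∘ₗ Coinvariants.mk τ ∘ₗ f.toLinearMap) :=
        LinearMap.trace_comp_comm' _ _
    _ = LinearMap.trace ℂ _ (avg ∘ₗ f.toLinearMap) := rfl
    _ = _ := by
        rw [LinearMap.smul_comp, ← Module.End.mul_eq_comp, Finset.sum_mul, map_smul, map_sum,
          smul_eq_mul]
        rfl

theorem trace_mapDomainLinearMap {G : Type*} [Fintype G] [DecidableEq G] (f : G → G) :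
    LinearMap.trace ℂ (MonoidAlgebra ℂ G) (MonoidAlgebra.mapDomainLinearMap ℂ ℂ f) =
      ∑ x, if f x = x then 1 else 0 := by
  let b : Module.Basis G ℂ (MonoidAlgebra ℂ G) :=
    .ofRepr (MonoidAlgebra.coeffLinearEquiv (S := ℂ) (R := ℂ) (M := G))
  rw [LinearMap.trace_eq_matrix_trace ℂ b, Matrix.trace]
  refine Finset.sum_congr rfl fun x _ => ?_
  rw [Matrix.diag_apply, LinearMap.toMatrix_apply]
  have hb : ∀ x, b x = MonoidAlgebra.single x 1 := fun x => rfl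
  rw [hb, MonoidAlgebra.mapDomainLinearMap_single]
  change (MonoidAlgebra.single (f x) (1 : ℂ)).coeff x = _
  simp [Finsupp.single_apply]

/-- The character of an induced representation. -/
theorem character_ind {G H : Type*} [Group G] [Group H] [Fintype G] [Fintype H] [DecidableEq G]
    (φ : H →* G) {V : Type*} [AddCommGroup V] [Module ℂ V] [Module.Finite ℂ V]
    (ρ : Representation ℂ H V) (g : G) :
    (ρ.ind φ).character g =
      (Fintype.card H : ℂ)⁻¹ * ∑ x : G, ∑ h : H, if φ h * x = x * g then ρ.character h else 0 := by
  have : Module.Finite ℂ (MonoidAlgebra ℂ G) :=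
    Module.Finite.equiv (MonoidAlgebra.coeffLinearEquiv (S := ℂ) (R := ℂ) (M := G)).symm
  rw [Representation.character]
  refine (trace_coinvariants_map _ _).trans ?_
  congr 1
  rw [Finset.sum_comm]
  refine Finset.sum_congr rfl fun h _ => ?_
  have key : ((Representation.tprod ((leftRegular ℂ G).comp φ) ρ) h) ∘ₗ
      ((MonoidAlgebra.mapDomainLinearMap ℂ ℂ fun x : G => x * g⁻¹).rTensor V) =
      TensorProduct.map (MonoidAlgebra.mapDomainLinearMap ℂ ℂ fun x : G => φ h * (x * g⁻¹)) (ρ h) := by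
    ext; simp
  refine (congrArg (LinearMap.trace ℂ _) key).trans ?_
  rw [LinearMap.trace_tensorProduct', trace_mapDomainLinearMap, Finset.sum_mul]
  refine Finset.sum_congr rfl fun x _ => ?_
  have : φ h * (x * g⁻¹) = x ↔ φ h * x = x * g := by
    rw [← mul_assoc, mul_inv_eq_iff_eq_mul]
  simp only [this, ite_mul, one_mul, zero_mul]
  rfl

theorem RepRing.ev_ind {G H : Type*} [Group G] [Group H] [Fintype G] [Fintype H] [DecidableEq G]
    (φ : H →* G) (g : G) (y : RepRing H) :
    RepRing.ev g (RepRing.ind φ y) = (Fintype.card H : ℂ)⁻¹ *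
      ∑ x : G, ∑ h : H, if φ h * x = x * g then RepRing.ev h y else 0 := by
  obtain ⟨a, b, rfl⟩ := exists_eq_of_sub_of y
  have key : ∀ a : IsoClass H, RepRing.ev g (RepRing.ind φ (of a)) = (Fintype.card H : ℂ)⁻¹ *
      ∑ x : G, ∑ h : H, if φ h * x = x * g then RepRing.ev h (of a) else 0 := fun a => by
    obtain ⟨_, ρ, rfl⟩ := IsoClass.exists_rep a
    simp only [ind_of, ev_of, IsoClass.ind_mk, IsoClass.char_mk, character_ind]
  rw [map_sub, map_sub, key, key, ← mul_sub]
  simp only [← Finset.sum_sub_distrib, map_sub]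
  congr 1
  refine Finset.sum_congr rfl fun x _ => Finset.sum_congr rfl fun h _ => ?_
  split_ifs <;> simp

theorem map_ev_mapCoeff_ind {G H : Type*} [Group G] [Group H] [Fintype G] [Fintype H]
    [DecidableEq G] (φ : H →* G) (g : G) (p : (RepRing H)[X]) :
    (mapCoeff (RepRing.ind φ) p).map (RepRing.ev g) = C ((Fintype.card H : ℂ)⁻¹) *
      ∑ x : G, ∑ h : H, if φ h * x = x * g then p.map (RepRing.ev h) else 0 := by
  ext i
  rw [coeff_map, coeff_mapCoeff, RepRing.ev_ind, coeff_C_mul]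
  simp only [finsetSum_coeff]
  congr 1
  refine Finset.sum_congr rfl fun x _ => Finset.sum_congr rfl fun h _ => ?_
  split_ifs <;> simp

end InducedCharacter

/-- A sum over a finite `G`-set, in terms of orbit representatives. -/
theorem sum_eq_sum_orbits {G B M : Type*} [Group G] [Fintype G] [Fintype B] [MulAction G B]
    [Ring M] [Algebra ℂ M] [Fintype (MulAction.orbitRel.Quotient G B)] (F : B → M) :
    ∑ b, F b = ∑ o : MulAction.orbitRel.Quotient G B,
      algebraMap ℂ M ((Nat.card (MulAction.stabilizer G o.out) : ℂ)⁻¹) *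
        ∑ x : G, F (x • o.out) := by
  classical
  rw [← Finset.sum_fiberwise Finset.univ
    (fun b => (Quotient.mk'' b : MulAction.orbitRel.Quotient G B)) F]
  refine Finset.sum_congr rfl fun o _ => ?_
  have hne : (Nat.card (MulAction.stabilizer G o.out) : ℂ) ≠ 0 :=
    Nat.cast_ne_zero.2 Nat.card_pos.ne'
  have hmaps : ∀ x ∈ (Finset.univ : Finset G), x • o.out ∈ Finset.univ.filter
      fun b => (Quotient.mk'' b : MulAction.orbitRel.Quotient G B) = o := fun x _ => by
    rw [Finset.mem_filter]
    refine ⟨Finset.mem_univ _, ?_⟩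
    rw [← Quotient.out_eq' o]
    refine Quotient.sound' ?_
    rw [Quotient.out_eq' o]
    exact ⟨x, rfl⟩
  rw [← Finset.sum_fiberwise_of_maps_to hmaps, Finset.mul_sum]
  refine Finset.sum_congr rfl fun b hb => ?_
  rw [Finset.mem_filter] at hb
  obtain ⟨y, hy⟩ : ∃ y : G, y • o.out = b := by
    have := hb.2
    rw [← Quotient.out_eq' o] at this
    exact Quotient.exact' this
  have hcongr : ∀ x ∈ Finset.univ.filter (fun x : G => x • o.out = b), F (x • o.out) = F b :=
    fun x hx => by rw [(Finset.mem_filter.1 hx).2]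
  rw [Finset.sum_congr rfl hcongr, Finset.sum_const]
  have hc : (Finset.univ.filter (fun x : G => x • o.out = b)).card =
      Nat.card (MulAction.stabilizer G o.out) := by
    rw [Nat.card_eq_fintype_card, Fintype.card_subtype]
    refine Finset.card_bij' (fun x _ => y⁻¹ * x) (fun x _ => y * x) ?_ ?_ ?_ ?_
    · intro x hx
      simp only [Finset.mem_filter, Finset.mem_univ, true_and, MulAction.mem_stabilizer_iff] at hx ⊢
      rw [mul_smul, hx, ← hy, inv_smul_smul]
    · intro x hx
      simp only [Finset.mem_filter, Finset.mem_univ, true_and, MulAction.mem_stabilizer_iff] at hx ⊢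
      rw [mul_smul, hx, hy]
    · simp
    · simp
  rw [hc, ← Nat.cast_smul_eq_nsmul ℂ, Algebra.smul_def, ← mul_assoc, ← map_mul,
    inv_mul_cancel₀ hne, map_one, one_mul]

section Evaluation

variable {W B : Type*} [Group W] [MulAction W B] [PartialOrder B]

theorem RepRing.ev_comp_pullback {G H : Type*} [Group G] [Group H] (φ : H →* G) (h : H) :
    (RepRing.ev h).comp (RepRing.pullback φ) = RepRing.ev (φ h) :=
  RingHom.ext fun x => RepRing.ev_pullback φ h x

open Classical in
/-- The evaluation of `p(z, z')` at `w`, extended by zero to all `w`, `z` and `z'`. -/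
def evFun (p : IncFun W B) (w : W) (z z' : B) : ℂ[X] :=
  if H : z ≤ z' ∧ w • z = z ∧ w • z' = z' then evAt p w z z' H.1 H.2.1 H.2.2 else 0

theorem evFun_eq (p : IncFun W B) {w : W} {z z' : B} (h : z ≤ z') (hz : w • z = z)
    (hz' : w • z' = z') : evFun p w z z' = evAt p w z z' h hz hz' :=
  dif_pos ⟨h, hz, hz'⟩

theorem evFun_of_not (p : IncFun W B) {w : W} {z z' : B}
    (H : ¬ (z ≤ z' ∧ w • z = z ∧ w • z' = z')) : evFun p w z z' = 0 :=
  dif_neg H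

theorem RepRing.polynomial_ext_ev {G : Type*} [Group G] [Finite G] {a b : (RepRing G)[X]}
    (h : ∀ g, a.map (RepRing.ev g) = b.map (RepRing.ev g)) : a = b := by
  ext i
  refine RepRing.ext_ev fun g => ?_
  rw [← coeff_map, ← coeff_map, h]

theorem IncFun.ext_evFun [Finite W] {p p' : IncFun W B}
    (h : ∀ w z z', evFun p w z z' = evFun p' w z z') : p = p' := by
  ext z z' hz : 1
  refine RepRing.polynomial_ext_ev fun g => ?_
  have := h g z z'
  rwa [evFun_eq p hz g.2.1 g.2.2, evFun_eq p' hz g.2.1 g.2.2] at this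

/-- The action of `W` on `B` is order-preserving. -/
def IsMonoAction (W B : Type*) [Group W] [MulAction W B] [PartialOrder B] : Prop :=
  ∀ (w : W) (z z' : B), z ≤ z' → w • z ≤ w • z'

theorem IsMonoAction.smul_le_smul_iff (hm : IsMonoAction W B) (w : W) (z z' : B) :
    w • z ≤ w • z' ↔ z ≤ z' :=
  ⟨fun h => by simpa using hm w⁻¹ _ _ h, hm w z z'⟩

theorem IsEquivariant.evFun_conj (hm : IsMonoAction W B) {p : IncFun W B} (hp : IsEquivariant p)
    (x w : W) (z z' : B) : evFun p (x * w * x⁻¹) (x • z) (x • z') = evFun p w z z' := by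
  have hfix : ∀ b : B, (x * w * x⁻¹) • x • b = x • b ↔ w • b = b := fun b => by
    rw [← mul_smul, inv_mul_cancel_right, mul_smul, smul_left_cancel_iff]
  by_cases H : z ≤ z' ∧ w • z = z ∧ w • z' = z'
  · obtain ⟨h, hz, hz'⟩ := H
    rw [evFun_eq p h hz hz', evFun_eq p (hm x _ _ h) ((hfix z).2 hz) ((hfix z').2 hz'), evAt, evAt,
      hp x z z' h (hm x _ _ h), Polynomial.map_map, RepRing.ev_comp_pullback]
    rfl
  · rw [evFun_of_not p H, evFun_of_not]
    rwa [hm.smul_le_smul_iff, hfix, hfix]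

theorem isEquivariant_of_evFun_conj [Finite W] {p : IncFun W B}
    (hp : ∀ x w z z', evFun p (x * w * x⁻¹) (x • z) (x • z') = evFun p w z z') :
    IsEquivariant p := by
  intro x z z' h h'
  refine RepRing.polynomial_ext_ev fun g => ?_
  have hfix : ∀ b : B, (g : W) • b = b → (x * g * x⁻¹) • x • b = x • b := fun b hb => by
    rw [← mul_smul, inv_mul_cancel_right, mul_smul, hb]
  have := hp x g z z'
  rw [evFun_eq p h g.2.1 g.2.2, evFun_eq p h' (hfix _ g.2.1) (hfix _ g.2.2)] at this
  rw [Polynomial.map_map, RepRing.ev_comp_pullback]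
  exact this.symm

theorem map_ev_mulTerm [Finite W] (hm : IsMonoAction W B) {p p' : IncFun W B}
    (hp : IsEquivariant p) (hp' : IsEquivariant p') {z b z' : B} (h : z ≤ b) (h' : b ≤ z')
    [Fintype (stab₂ W z z')] (g : stab₂ W z z') :
    (IncFun.mulTerm p p' z b z' h h').map (RepRing.ev g) =
      C ((Nat.card (MulAction.stabilizer (stab₂ W z z') b) : ℂ)⁻¹) *
        ∑ x : stab₂ W z z', evFun p g z (x • b) * evFun p' g (x • b) z' := by
  classical
  cases nonempty_fintype W
  rw [IncFun.mulTerm, map_ev_mapCoeff_ind]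
  have hcard : Fintype.card (stab₃ W z b z') =
      Nat.card (MulAction.stabilizer (stab₂ W z z') b) := by
    rw [← Nat.card_eq_fintype_card]
    exact Nat.card_congr
      { toFun := fun x => ⟨⟨x, stab₃_le W z b z' x.2⟩, x.2.1.2⟩
        invFun := fun x => ⟨x.1, ⟨x.1.2.1, x.2⟩, x.1.2.2⟩
        left_inv := fun _ => rfl
        right_inv := fun _ => rfl }
  rw [hcard]
  congr 1
  refine Fintype.sum_equiv (Equiv.inv _) _ _ fun x => ?_
  have hx : evFun p g z (x⁻¹ • b) * evFun p' g (x⁻¹ • b) z' =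
      evFun p ((x : W) * g * (x : W)⁻¹) z b * evFun p' ((x : W) * g * (x : W)⁻¹) b z' := by
    have hz : (x : W) • z = z := x.2.1
    have hz' : (x : W) • z' = z' := x.2.2
    rw [← hp.evFun_conj hm x g, ← hp'.evFun_conj hm x g, hz, hz']
    have : (x : W) • (x⁻¹ • b) = b := smul_inv_smul x b
    rw [this]
  rw [Equiv.inv_apply, hx]
  have hgz : ((x : W) * g * (x : W)⁻¹) • z = z := (x * g * x⁻¹).2.1
  have hgz' : ((x : W) * g * (x : W)⁻¹) • z' = z' := (x * g * x⁻¹).2.2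
  by_cases hb : ((x : W) * g * (x : W)⁻¹) • b = b
  · rw [Finset.sum_eq_single ⟨(x : W) * g * (x : W)⁻¹, ⟨hgz, hb⟩, hgz'⟩]
    · rw [if_pos, evFun_eq p h hgz hb, evFun_eq p' h' hb hgz', Polynomial.map_mul,
        Polynomial.map_map, Polynomial.map_map, RepRing.ev_comp_pullback,
        RepRing.ev_comp_pullback]
      · rfl
      · exact Subtype.ext (inv_mul_cancel_right _ _)
    · intro y _ hy
      refine if_neg fun hyx => hy (Subtype.ext ?_)
      exact eq_mul_inv_of_mul_eq (congrArg Subtype.val hyx)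
    · simp
  · rw [evFun_of_not p fun H => hb H.2.2, zero_mul]
    refine Finset.sum_eq_zero fun y _ => if_neg fun hyx => hb ?_
    have : (y : W) = x * g * (x : W)⁻¹ := eq_mul_inv_of_mul_eq (congrArg Subtype.val hyx)
    rw [← this]
    exact y.2.1.2

/-- Evaluation at `w` turns the product of the equivariant incidence algebra into the product of
the incidence algebra of `B ^ w`. -/
theorem evFun_mul [Finite W] [Fintype B] (hm : IsMonoAction W B) {p p' : IncFun W B}
    (hp : IsEquivariant p) (hp' : IsEquivariant p') (w : W) (z z' : B) :
    evFun (p * p') w z z' = ∑ b, evFun p w z b * evFun p' w b z' := by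
  classical
  cases nonempty_fintype W
  by_cases H : z ≤ z' ∧ w • z = z ∧ w • z' = z'
  · obtain ⟨h, hz, hz'⟩ := H
    have hg : w ∈ stab₂ W z z' := ⟨hz, hz'⟩
    rw [evFun_eq _ h hz hz', sum_eq_sum_orbits (G := stab₂ W z z')]
    change Polynomial.map _ (∑ᶠ o : MulAction.orbitRel.Quotient (stab₂ W z z') B,
      if h : z ≤ o.out ∧ o.out ≤ z' then IncFun.mulTerm p p' z o.out z' h.1 h.2 else 0) = _
    rw [finsum_eq_sum_of_fintype, Polynomial.map_sum]
    refine Finset.sum_congr rfl fun o _ => ?_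
    split_ifs with ho
    · exact map_ev_mulTerm hm hp hp' ho.1 ho.2 ⟨w, hg⟩
    · rw [Polynomial.map_zero, Finset.sum_eq_zero, mul_zero]
      intro x _
      have h₁ : z ≤ x • o.out ↔ z ≤ o.out := by
        have hx : (x : W) • z = z := x.2.1
        have := hm.smul_le_smul_iff x z o.out
        rwa [hx] at this
      have h₂ : x • o.out ≤ z' ↔ o.out ≤ z' := by
        have hx : (x : W) • z' = z' := x.2.2
        have := hm.smul_le_smul_iff x o.out z'
        rwa [hx] at this
      by_cases hzx : z ≤ o.out
      · rw [evFun_of_not p' fun H => ho ⟨hzx, h₂.1 H.1⟩, mul_zero]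
      · rw [evFun_of_not p fun H => hzx (h₁.1 H.1), zero_mul]
  · rw [evFun_of_not _ H, Finset.sum_eq_zero]
    intro b _
    by_cases hb : z ≤ b ∧ w • z = z ∧ w • b = b
    · rw [evFun_of_not p' fun H' => H ⟨hb.1.trans H'.1, hb.2.1, H'.2.2⟩, mul_zero]
    · rw [evFun_of_not p hb, zero_mul]

end Evaluation

section HalfPolynomials

variable {R S : Type*} [CommRing R] [CommRing S]

/-- The part of degree less than `n / 2` of a polynomial. -/
def truncHalf (n : ℕ) (p : R[X]) : R[X] :=
  ∑ i ∈ Finset.range ((n + 1) / 2), monomial i (p.coeff i)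

theorem coeff_truncHalf (n : ℕ) (p : R[X]) (i : ℕ) :
    (truncHalf n p).coeff i = if 2 * i < n then p.coeff i else 0 := by
  have h : i < (n + 1) / 2 ↔ 2 * i < n := by omega
  simp only [truncHalf, finsetSum_coeff, coeff_monomial, Finset.sum_ite_eq', Finset.mem_range, h]

theorem map_truncHalf (f : R →+* S) (n : ℕ) (p : R[X]) :
    (truncHalf n p).map f = truncHalf n (p.map f) := by
  ext i
  rw [coeff_map, coeff_truncHalf, coeff_truncHalf, coeff_map]
  split_ifs <;> simp

@[simp] theorem truncHalf_zero (n : ℕ) : truncHalf n (0 : R[X]) = 0 := by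
  ext i
  simp [coeff_truncHalf]

theorem two_mul_natDegree_lt {n : ℕ} (hn : 0 < n) {p : R[X]}
    (hp : ∀ i, n ≤ 2 * i → p.coeff i = 0) : 2 * p.natDegree < n := by
  by_contra h
  have h' := hp p.natDegree (by omega)
  rw [coeff_natDegree, leadingCoeff_eq_zero] at h'
  rw [h', natDegree_zero] at h
  omega

theorem two_mul_natDegree_truncHalf_lt {n : ℕ} (hn : 0 < n) (p : R[X]) :
    2 * (truncHalf n p).natDegree < n :=
  two_mul_natDegree_lt hn fun i hi => by rw [coeff_truncHalf, if_neg (by omega)]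

theorem coeff_eq_zero_of_half {n : ℕ} {p : R[X]} (hp : 2 * p.natDegree < n) {i : ℕ}
    (hi : n ≤ 2 * i) : p.coeff i = 0 :=
  coeff_eq_zero_of_natDegree_lt (by omega)

theorem eq_zero_of_reflect_eq_self {n : ℕ} {p : R[X]} (hp : 2 * p.natDegree < n)
    (h : p.reflect n = p) : p = 0 := by
  ext i
  rw [coeff_zero]
  by_cases hi : n ≤ 2 * i
  · exact coeff_eq_zero_of_half hp hi
  · rw [← h, coeff_reflect, revAt_le (by omega)]
    exact coeff_eq_zero_of_half hp (by omega)

theorem reflect_truncHalf_sub [IsAddTorsionFree R] {n : ℕ} {p : R[X]} (hp : p.natDegree ≤ n)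
    (h : p.reflect n = -p) : (-truncHalf n p).reflect n - (-truncHalf n p) = p := by
  have hc : ∀ i, i ≤ n → p.coeff (n - i) = -p.coeff i := fun i hi => by
    rw [← coeff_neg, ← h, coeff_reflect, revAt_le hi]
  ext i
  rw [coeff_sub, coeff_reflect, coeff_neg, coeff_neg, coeff_truncHalf, coeff_truncHalf]
  by_cases hi : i ≤ n
  · rw [revAt_le hi, hc i hi]
    split_ifs with h₁ h₂ h₂
    · omega
    · simp
    · simp
    · have h₃ := hc i hi
      rw [show n - i = i by omega, self_eq_neg] at h₃
      simp [h₃]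
  · rw [revAt_eq_self_of_lt (by omega), coeff_eq_zero_of_natDegree_lt (by omega : p.natDegree < i)]
    simp

/-- The polynomial operation underlying `Δ`. -/
def deltaPoly (n : ℕ) (p : R[X]) : R[X] :=
  C (p.coeff 0) + ∑ i ∈ Finset.Icc 1 ((n - 1) / 2), monomial i (p.coeff i - p.coeff (i - 1))

theorem map_deltaPoly (f : R →+* S) (n : ℕ) (p : R[X]) :
    (deltaPoly n p).map f = deltaPoly n (p.map f) := by
  simp [deltaPoly, Polynomial.map_sum]

@[simp] theorem deltaPoly_zero (n : ℕ) : deltaPoly n (0 : R[X]) = 0 := by simp [deltaPoly]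

theorem deltaPoly_eq_truncHalf {n : ℕ} (hn : 0 < n) (p : R[X]) :
    deltaPoly n p = truncHalf n ((1 - X) * p) := by
  ext i
  rw [coeff_truncHalf, sub_mul, one_mul, coeff_sub, deltaPoly, coeff_add, coeff_C, finsetSum_coeff]
  simp only [coeff_monomial, Finset.sum_ite_eq', Finset.mem_Icc]
  cases i with
  | zero => simp [hn]
  | succ i =>
    have : i < (n - 1) / 2 ↔ 2 * (i + 1) < n := by omega
    simp [this, coeff_X_mul]

theorem natDegree_deltaPoly_le (n : ℕ) (p : R[X]) : (deltaPoly n p).natDegree ≤ n := by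
  rcases Nat.eq_zero_or_pos n with rfl | hn
  · simp [deltaPoly]
  · have := two_mul_natDegree_truncHalf_lt hn ((1 - X) * p)
    rw [deltaPoly_eq_truncHalf hn]
    omega

theorem deltaPoly_C_mul (n : ℕ) (c : R) (p : R[X]) :
    deltaPoly n (C c * p) = C c * deltaPoly n p := by
  simp only [deltaPoly, coeff_C_mul, mul_add, Finset.mul_sum, C_mul_monomial, C_mul, mul_sub]

theorem deltaPoly_eq_of_reflect_sub {n : ℕ} (hn : 0 < n) {p a : R[X]} (ha : 2 * a.natDegree < n)
    (h : (X - 1) * p = a.reflect n - a) : deltaPoly n p = a := by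
  have h' : (1 - X) * p = a - a.reflect n := by rw [← neg_sub, neg_mul, h, neg_sub]
  rw [deltaPoly_eq_truncHalf hn, h']
  ext i
  rw [coeff_truncHalf, coeff_sub, coeff_reflect]
  split_ifs with hi
  · rw [revAt_le (by omega), coeff_eq_zero_of_half ha (i := n - i) (by omega), sub_zero]
  · exact (coeff_eq_zero_of_half ha (by omega)).symm

end HalfPolynomials

section Triangular

variable {P : Type*} [PartialOrder P]

theorem IsWeakRank.self {r : P → P → ℕ} (hr : IsWeakRank r) (i : P) : r i i = 0 := by
  have := hr.add i i i le_rfl le_rfl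
  omega

/-- Matrices with the support and degrees of an element of the incidence algebra of `P` bounded
by the weak rank function `r`. -/
structure IsBounded (r : P → P → ℕ) (M : Matrix P P ℂ[X]) : Prop where
  le : ∀ i j, M i j ≠ 0 → i ≤ j
  deg : ∀ i j, (M i j).natDegree ≤ r i j

/-- Bounded matrices with entries of degree less than `r / 2` off the diagonal. -/
structure IsHalfBounded (r : P → P → ℕ) (M : Matrix P P ℂ[X]) : Prop extends IsBounded r M where
  half : ∀ i j, i < j → 2 * (M i j).natDegree < r i j

/-- The reversal of a matrix of polynomials. -/
def revM (r : P → P → ℕ) (M : Matrix P P ℂ[X]) : Matrix P P ℂ[X] :=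
  Matrix.of fun i j => (M i j).reflect (r i j)

variable {r : P → P → ℕ} {M N : Matrix P P ℂ[X]}

omit [PartialOrder P] in
theorem revM_apply (i j : P) : revM r M i j = (M i j).reflect (r i j) := rfl

theorem IsBounded.eq_zero (hM : IsBounded r M) {i j : P} (h : ¬ i ≤ j) : M i j = 0 := by
  by_contra h'
  exact h (hM.le i j h')

theorem IsBounded.revM (hM : IsBounded r M) : IsBounded r (revM r M) where
  le i j h := hM.le i j fun h' => h (by rw [revM_apply, h', reflect_zero])
  deg i j := natDegree_reflect_le.trans (max_le le_rfl (hM.deg i j))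

variable [Fintype P]

theorem IsBounded.mul (hr : IsWeakRank r) (hM : IsBounded r M) (hN : IsBounded r N) :
    IsBounded r (M * N) where
  le i j h := by
    obtain ⟨k, -, hk⟩ := Finset.exists_ne_zero_of_sum_ne_zero h
    exact (hM.le i k (left_ne_zero_of_mul hk)).trans (hN.le k j (right_ne_zero_of_mul hk))
  deg i j := by
    rw [Matrix.mul_apply]
    refine natDegree_sum_le_of_forall_le _ _ fun k _ => ?_
    by_cases hk : M i k * N k j = 0
    · rw [hk, natDegree_zero]
      exact Nat.zero_le _
    · rw [hr.add i k j (hM.le i k (left_ne_zero_of_mul hk)) (hN.le k j (right_ne_zero_of_mul hk))]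
      exact natDegree_mul_le.trans (add_le_add (hM.deg i k) (hN.deg k j))

theorem revM_mul (hr : IsWeakRank r) (hM : IsBounded r M) (hN : IsBounded r N) :
    revM r (M * N) = revM r M * revM r N := by
  ext1 i j
  rw [Matrix.mul_apply, revM_apply, Matrix.mul_apply]
  have hsum : ∀ s : Finset P, (∑ k ∈ s, M i k * N k j).reflect (r i j) =
      ∑ k ∈ s, (M i k * N k j).reflect (r i j) := fun s => by
    classical
    induction s using Finset.induction_on with
    | empty => simp
    | insert a s ha ih => rw [Finset.sum_insert ha, Finset.sum_insert ha, reflect_add, ih]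
  rw [hsum]
  refine Finset.sum_congr rfl fun k _ => ?_
  rw [revM_apply, revM_apply]
  by_cases h₁ : M i k = 0
  · simp [h₁]
  by_cases h₂ : N k j = 0
  · simp [h₂]
  rw [hr.add i k j (hM.le i k h₁) (hN.le k j h₂), reflect_mul _ _ (hM.deg i k) (hN.deg k j)]

theorem IsBounded.mul_apply_self (hM : IsBounded r M) (hN : IsBounded r N) (i : P) :
    (M * N) i i = M i i * N i i := by
  rw [Matrix.mul_apply, Finset.sum_eq_single i]
  · intro k _ hk
    by_cases h : i ≤ k
    · rw [hN.eq_zero fun h' => hk (le_antisymm h' h), mul_zero]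
    · rw [hM.eq_zero h, zero_mul]
  · simp

theorem IsHalfBounded.mul (hr : IsWeakRank r) (hM : IsHalfBounded r M) (hN : IsHalfBounded r N) :
    IsHalfBounded r (M * N) where
  toIsBounded := hM.toIsBounded.mul hr hN.toIsBounded
  half i j hij := by
    have hpos := hr.pos i j hij
    refine two_mul_natDegree_lt hpos fun m hm => ?_
    rw [Matrix.mul_apply, finsetSum_coeff]
    refine Finset.sum_eq_zero fun k _ => ?_
    by_cases h₁ : M i k = 0
    · simp [h₁]
    by_cases h₂ : N k j = 0
    · simp [h₂]
    refine coeff_eq_zero_of_natDegree_lt ?_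
    have hik := hM.le i k h₁
    have hkj := hN.le k j h₂
    have hadd := hr.add i k j hik hkj
    have hdeg : (M i k * N k j).natDegree ≤ _ := natDegree_mul_le
    have hMdeg := hM.deg i k
    have hNdeg := hN.deg k j
    rcases hik.eq_or_lt with rfl | hik
    · have := hN.half _ _ hij
      have := hr.self i
      omega
    · have h₃ := hM.half _ _ hik
      rcases hkj.eq_or_lt with rfl | hkj
      · have := hr.self k
        omega
      · have := hN.half _ _ hkj
        omega

variable [DecidableEq P]

omit [Fintype P] in
theorem IsHalfBounded.eq_one (hM : IsHalfBounded r M) (hM₁ : ∀ i, M i i = 1) (h : revM r M = M) : M = 1 := by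
  ext1 i j
  by_cases hij : i = j
  · subst hij
    rw [hM₁, Matrix.one_apply_eq]
  · rw [Matrix.one_apply_ne hij]
    by_cases hle : i ≤ j
    · exact eq_zero_of_reflect_eq_self (hM.half i j (lt_of_le_of_ne hle hij))
        (congrFun (congrFun h i) j)
    · exact hM.eq_zero hle

/-- Solutions of the recursion for the right Kazhdan-Lusztig-Stanley function satisfy its
defining equation. -/
theorem revM_eq_mul_of_recursion (hr : IsWeakRank r) {K M : Matrix P P ℂ[X]} (hK : IsBounded r K)
    (hK₁ : ∀ i, K i i = 1) (hKinv : revM r K * K = 1) (hM : IsBounded r M)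
    (hrec : ∀ i j, M i j = if i = j then 1 else -truncHalf (r i j) ((K * M - M) i j)) :
    revM r M = K * M := by
  have hKM := hK.mul hr hM
  suffices h : ∀ n i j, r i j = n → revM r M i j = (K * M) i j from
    Matrix.ext fun i j => h _ i j rfl
  intro n
  induction n using Nat.strong_induction_on with
  | _ n ih =>
  rintro i j rfl
  by_cases hij : i = j
  · subst hij
    have h₁ : M i i = 1 := by rw [hrec, if_pos rfl]
    rw [revM_apply, hK.mul_apply_self hM, hK₁, h₁, hr.self, reflect_one, pow_zero, one_mul]
  by_cases hle : i ≤ j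
  · have hE : revM r (K * M) - M = revM r K * (revM r M - K * M) := by
      rw [mul_sub, ← mul_assoc, hKinv, one_mul, revM_mul hr hK hM]
    have hEij := congrFun (congrFun hE i) j
    rw [Matrix.mul_apply, Finset.sum_eq_single i] at hEij
    · have h₁ : revM r K i i = 1 := by
        rw [revM_apply, hK₁, hr.self, reflect_one, pow_zero]
      rw [h₁, one_mul, Matrix.sub_apply, Matrix.sub_apply, revM_apply, revM_apply] at hEij
      have hdeg : ((K * M - M) i j).natDegree ≤ r i j :=
        (natDegree_sub_le _ _).trans (max_le (hKM.deg i j) (hM.deg i j))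
      have hQ : ((K * M - M) i j).reflect (r i j) = -(K * M - M) i j := by
        rw [Matrix.sub_apply, reflect_sub]
        linear_combination hEij
      have := reflect_truncHalf_sub hdeg hQ
      rw [show -truncHalf (r i j) ((K * M - M) i j) = M i j by rw [hrec i j, if_neg hij],
        Matrix.sub_apply] at this
      rw [revM_apply]
      linear_combination this
    · intro k _ hk
      by_cases hik : i ≤ k
      · by_cases hkj : k ≤ j
        · have hlt : r k j < r i j := by
            have := hr.add i k j hik hkj
            have := hr.pos i k (lt_of_le_of_ne hik (Ne.symm hk))
            omega
          rw [Matrix.sub_apply, ih _ hlt k j rfl, sub_self, mul_zero]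
        · rw [Matrix.sub_apply, hM.revM.eq_zero hkj, hKM.eq_zero hkj, sub_self, mul_zero]
      · rw [hK.revM.eq_zero hik, zero_mul]
    · simp
  · rw [hM.revM.eq_zero hle, hKM.eq_zero hle]

/-- Solutions of the recursion for the left Kazhdan-Lusztig-Stanley function satisfy its
defining equation. -/
theorem revM_eq_mul_of_recursion' (hr : IsWeakRank r) {K M : Matrix P P ℂ[X]} (hK : IsBounded r K)
    (hK₁ : ∀ i, K i i = 1) (hKinv : K * revM r K = 1) (hM : IsBounded r M)
    (hrec : ∀ i j, M i j = if i = j then 1 else -truncHalf (r i j) ((M * K - M) i j)) :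
    revM r M = M * K := by
  have hMK := hM.mul hr hK
  suffices h : ∀ n i j, r i j = n → revM r M i j = (M * K) i j from
    Matrix.ext fun i j => h _ i j rfl
  intro n
  induction n using Nat.strong_induction_on with
  | _ n ih =>
  rintro i j rfl
  by_cases hij : i = j
  · subst hij
    have h₁ : M i i = 1 := by rw [hrec, if_pos rfl]
    rw [revM_apply, hM.mul_apply_self hK, hK₁, h₁, hr.self, reflect_one, pow_zero, one_mul]
  by_cases hle : i ≤ j
  · have hE : revM r (M * K) - M = (revM r M - M * K) * revM r K := by
      rw [sub_mul, mul_assoc, hKinv, mul_one, revM_mul hr hM hK]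
    have hEij := congrFun (congrFun hE i) j
    rw [Matrix.mul_apply, Finset.sum_eq_single j] at hEij
    · have h₁ : revM r K j j = 1 := by
        rw [revM_apply, hK₁, hr.self, reflect_one, pow_zero]
      rw [h₁, mul_one, Matrix.sub_apply, Matrix.sub_apply, revM_apply, revM_apply] at hEij
      have hdeg : ((M * K - M) i j).natDegree ≤ r i j :=
        (natDegree_sub_le _ _).trans (max_le (hMK.deg i j) (hM.deg i j))
      have hQ : ((M * K - M) i j).reflect (r i j) = -(M * K - M) i j := by
        rw [Matrix.sub_apply, reflect_sub]
        linear_combination hEij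
      have := reflect_truncHalf_sub hdeg hQ
      rw [show -truncHalf (r i j) ((M * K - M) i j) = M i j by rw [hrec i j, if_neg hij],
        Matrix.sub_apply] at this
      rw [revM_apply]
      linear_combination this
    · intro k _ hk
      by_cases hkj : k ≤ j
      · by_cases hik : i ≤ k
        · have hlt : r i k < r i j := by
            have := hr.add i k j hik hkj
            have := hr.pos k j (lt_of_le_of_ne hkj hk)
            omega
          rw [Matrix.sub_apply, ih _ hlt i k rfl, sub_self, zero_mul]
        · rw [Matrix.sub_apply, hM.revM.eq_zero hik, hMK.eq_zero hik, sub_self, zero_mul]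
      · rw [hK.revM.eq_zero hkj, mul_zero]
    · simp
  · rw [hM.revM.eq_zero hle, hMK.eq_zero hle]

end Triangular

section Hat

variable {P : Type*} [DecidableEq P]

/-- The diagonal matrix of the signs `(-1) ^ ρ`. -/
def signM (ρ : P → ℤ) : Matrix P P ℂ[X] := Matrix.diagonal fun i => C ((-1 : ℂ) ^ ρ i)

variable [Fintype P]

/-- Conjugation by `signM ρ`. -/
def hatM (ρ : P → ℤ) (M : Matrix P P ℂ[X]) : Matrix P P ℂ[X] := signM ρ * M * signM ρ

variable {ρ : P → ℤ} {M N : Matrix P P ℂ[X]}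

theorem hatM_apply (i j : P) : hatM ρ M i j = C ((-1 : ℂ) ^ (ρ j - ρ i)) * M i j := by
  rw [hatM, signM, Matrix.mul_diagonal, Matrix.diagonal_mul, mul_right_comm, ← C_mul,
    zpow_sub₀ (by norm_num), div_eq_mul_inv, ← inv_zpow, inv_neg_one, mul_comm ((-1 : ℂ) ^ ρ j)]

theorem signM_mul_signM : signM ρ * signM ρ = 1 := by
  rw [signM, Matrix.diagonal_mul_diagonal, ← Matrix.diagonal_one]
  congr 1
  ext1 i
  rw [← C_mul, ← mul_zpow]
  simp

theorem hatM_mul : hatM ρ (M * N) = hatM ρ M * hatM ρ N := by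
  have h : hatM ρ M * hatM ρ N = signM ρ * M * (signM ρ * signM ρ) * N * signM ρ := by
    simp only [hatM, mul_assoc]
  rw [h, signM_mul_signM, mul_one, hatM, ← mul_assoc (signM ρ)]

theorem hatM_one : hatM ρ (1 : Matrix P P ℂ[X]) = 1 := by
  rw [hatM, mul_one, signM_mul_signM]

theorem hatM_hatM : hatM ρ (hatM ρ M) = M := by
  have h : hatM ρ (hatM ρ M) = (signM ρ * signM ρ) * M * (signM ρ * signM ρ) := by
    simp only [hatM, mul_assoc]
  rw [h, signM_mul_signM, one_mul, mul_one]

theorem hatM_smul (a : ℂ[X]) : hatM ρ (a • M) = a • hatM ρ M := by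
  rw [hatM, hatM, Matrix.mul_smul, Matrix.smul_mul]

theorem hatM_diagonal (d : P → ℂ[X]) : hatM ρ (Matrix.diagonal d) = Matrix.diagonal d := by
  ext1 i j
  rw [hatM_apply]
  by_cases h : i = j
  · subst h
    simp
  · rw [Matrix.diagonal_apply_ne _ h, mul_zero]

theorem hatM_apply_self (i : P) : hatM ρ M i i = M i i := by
  rw [hatM_apply, sub_self, zpow_zero, C_1, one_mul]

theorem natDegree_hatM (i j : P) : (hatM ρ M i j).natDegree = (M i j).natDegree := by
  rw [hatM_apply]
  exact natDegree_C_mul (zpow_ne_zero _ (by norm_num))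

theorem hatM_apply_eq_zero {i j : P} (h : M i j = 0) : hatM ρ M i j = 0 := by
  rw [hatM_apply, h, mul_zero]

theorem revM_hatM {r : P → P → ℕ} : revM r (hatM ρ M) = hatM ρ (revM r M) := by
  ext1 i j
  rw [revM_apply, hatM_apply, hatM_apply, reflect_C_mul, revM_apply]

variable [PartialOrder P]

theorem IsBounded.hatM {r : P → P → ℕ} (hM : IsBounded r M) : IsBounded r (hatM ρ M) where
  le i j h := hM.le i j fun h' => h (hatM_apply_eq_zero h')
  deg i j := by rw [natDegree_hatM]; exact hM.deg i j

theorem IsHalfBounded.hatM {r : P → P → ℕ} (hM : IsHalfBounded r M) :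
    IsHalfBounded r (hatM ρ M) where
  toIsBounded := hM.toIsBounded.hatM
  half i j h := by rw [natDegree_hatM]; exact hM.half i j h

omit [DecidableEq P] in
/-- Two rank functions differ by a constant on every interval. -/
theorem IsRankFunction.sub_eq_sub {ρ ρ' : P → ℤ} (hρ : IsRankFunction ρ) (hρ' : IsRankFunction ρ')
    {i j : P} (h : i ≤ j) : ρ j - ρ i = ρ' j - ρ' i := by
  induction j using WellFoundedLT.induction with
  | _ j ih =>
  rcases h.eq_or_lt with rfl | hlt
  · simp
  · obtain ⟨k, hik, hkj⟩ := exists_le_covBy_of_lt hlt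
    have h₁ := ih k hkj.lt hik
    have h₂ := hρ k j hkj
    have h₃ := hρ' k j hkj
    omega

theorem IsBounded.hatM_eq_hatM {r : P → P → ℕ} (hM : IsBounded r M) {ρ ρ' : P → ℤ}
    (hρ : IsRankFunction ρ) (hρ' : IsRankFunction ρ') :
    EquivKLS.hatM ρ M = EquivKLS.hatM ρ' M := by
  ext1 i j
  by_cases h : i ≤ j
  · rw [hatM_apply, hatM_apply, hρ.sub_eq_sub hρ' h]
  · rw [hatM_apply, hatM_apply, hM.eq_zero h, mul_zero, mul_zero]

/-- A multiplicative matrix and its hat are inverse to each other. -/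
theorem mul_hatM_eq_one {r : P → P → ℕ} {K : Matrix P P ℂ[X]} (hK : IsBounded r K)
    (hK₁ : ∀ i, K i i = 1) (hmul : ∀ i k j, i ≤ k → k ≤ j → K i j = K i k * K k j)
    (hρ : IsLowerEulerianWith ρ) : K * hatM ρ K = 1 := by
  ext1 i j
  by_cases hij : i = j
  · subst hij
    rw [hK.mul_apply_self (hK.hatM (ρ := ρ)), hatM_apply_self, hK₁, mul_one, Matrix.one_apply_eq]
  rw [Matrix.one_apply_ne hij]
  by_cases hle : i ≤ j
  · classical
    have hsum := hρ.sum_eq_zero i j (lt_of_le_of_ne hle hij)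
    rw [finsum_mem_eq_finite_toFinset_sum _ (Set.toFinite _)] at hsum
    have hterm : ∀ k, K i k * hatM ρ K k j =
        if k ∈ (Set.toFinite (Set.Icc i j)).toFinset then
          C (((ρ k).negOnePow : ℤ) : ℂ) * (C ((-1 : ℂ) ^ ρ j) * K i j) else 0 := by
      intro k
      simp only [Set.Finite.mem_toFinset, Set.mem_Icc]
      split_ifs with hk
      · rw [hatM_apply, hmul i k j hk.1 hk.2, Int.cast_negOnePow, zpow_sub₀ (by norm_num),
          div_eq_mul_inv, ← inv_zpow, inv_neg_one, C_mul]
        ring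
      · by_cases hik : i ≤ k
        · rw [hK.hatM.eq_zero fun hkj => hk ⟨hik, hkj⟩, mul_zero]
        · rw [hK.eq_zero hik, zero_mul]
    rw [Matrix.mul_apply, Finset.sum_congr rfl fun k _ => hterm k, Finset.sum_ite_mem,
      Finset.univ_inter, ← Finset.sum_mul, ← map_sum]
    have : (∑ k ∈ (Set.toFinite (Set.Icc i j)).toFinset, (((ρ k).negOnePow : ℤ) : ℂ)) = 0 := by
      exact_mod_cast hsum
    rw [this, C_0, zero_mul]
  · rw [Matrix.mul_apply]
    refine Finset.sum_eq_zero fun k _ => ?_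
    by_cases hik : i ≤ k
    · rw [hK.hatM.eq_zero fun hkj => hle (hik.trans hkj), mul_zero]
    · rw [hK.eq_zero hik, zero_mul]

omit [DecidableEq P] [Fintype P] [PartialOrder P] in
theorem eval_one_reflect {n : ℕ} {p : ℂ[X]} (hp : p.natDegree ≤ n) :
    (p.reflect n).eval 1 = p.eval 1 := by
  let _ : Invertible (1 : ℂ) := invertibleOne
  have := eval₂_reflect_mul_pow (RingHom.id ℂ) 1 n p hp
  simpa [eval₂_eq_eval_map] using this

/-- The entries of a rank alternating multiplicative matrix vanish at `t = 1`. -/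
theorem eval_one_eq_zero {r : P → P → ℕ} {K : Matrix P P ℂ[X]} (hK : IsBounded r K)
    (hmul : ∀ i k j, i ≤ k → k ≤ j → K i j = K i k * K k j) (hρ : IsRankFunction ρ)
    (halt : revM r K = hatM ρ K) {i j : P} (hij : i < j) : (K i j).eval 1 = 0 := by
  obtain ⟨k, hik, hkj⟩ := exists_covBy_le_of_lt hij
  have h₁ := congrArg (eval 1) (congrFun (congrFun halt i) k)
  rw [revM_apply, eval_one_reflect (hK.deg i k), hatM_apply, hρ i k hik] at h₁
  have h₂ : (K i k).eval 1 = 0 := by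
    simp only [add_sub_cancel_left, zpow_one, eval_mul, eval_C, neg_mul, one_mul] at h₁
    exact self_eq_neg.1 h₁
  rw [hmul i k j hik.le hkj, eval_mul, h₂, zero_mul]

/-- The left function of a rank alternating kernel is inverse to the hat of the right one. -/
theorem mul_hatM_eq_one_of_revM {r : P → P → ℕ} (hr : IsWeakRank r) {K F G : Matrix P P ℂ[X]}
    (hinv : K * hatM ρ K = 1)
    (hF : IsHalfBounded r F) (hF₁ : ∀ i, F i i = 1) (hFrev : revM r F = K * F)
    (hG : IsHalfBounded r G) (hG₁ : ∀ i, G i i = 1) (hGrev : revM r G = G * K) :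
    G * hatM ρ F = 1 := by
  have hFh := hF.hatM (ρ := ρ)
  refine (hG.mul hr hFh).eq_one (fun i => ?_) ?_
  · rw [hG.mul_apply_self hFh.toIsBounded, hatM_apply_self, hF₁, hG₁, one_mul]
  · rw [revM_mul hr hG.toIsBounded hFh.toIsBounded, revM_hatM, hFrev, hGrev, hatM_mul, mul_assoc,
      ← mul_assoc K, hinv, one_mul]

end Hat

section Blocks

variable {R : Type*} [Ring R] {e e' G G' K K' F J : R}

/-- The computation of `a^rev - a` for `a = g|_{X/Y} g⁻¹`. -/
theorem block_rev_sub (h₁ : e + e' = 1) (hG : G * e = e * G * e) (hK : e' * K = e' * K * e')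
    (hKK' : K * K' = 1) (hJ' : J = e * K * e' * K') :
    e * (G * K) * e' * (K' * G') - e * G * e' * G' = G * J * G' := by
  have h₂ : e * (G * K) * e' * (K' * G') =
      e * G * (e + e') * K * e' * K' * G' := by rw [h₁]; noncomm_ring
  have h₃ : e * G * (e + e') * K * e' * K' * G' =
      (e * G * e) * (K * e' * K') * G' + e * G * (e' * K * e') * K' * G' := by noncomm_ring
  have h₄ : (e * G * e) * (K * e' * K') * G' = G * J * G' := by
    rw [← hG, hJ']; noncomm_ring
  have h₅ : e * G * (e' * K * e') * K' * G' = e * G * e' * (K * K') * G' := by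
    rw [← hK]; noncomm_ring
  rw [h₂, h₃, h₄, h₅, hKK', mul_one, add_sub_cancel_right]

theorem block_right (h₁ : e + e' = 1) (hF : e' * F = e' * F * e') (hG : e' * G = e' * G * e')
    (hFG : F * G = 1) (hGF : G * F = 1) : F * (e * G * e' * F) = -(e * F * e') := by
  have he : e = 1 - e' := eq_sub_of_add_eq h₁
  calc F * (e * G * e' * F) = F * G * e' * F - F * (e' * G * e') * F := by
        rw [he]; noncomm_ring
    _ = e' * F - F * e' * (G * F) := by rw [← hG, hFG]; noncomm_ring
    _ = e' * F * e' - F * e' := by rw [hGF, mul_one, ← hF]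
    _ = _ := by rw [he]; noncomm_ring

theorem block_Z (h₁ : e + e' = 1) (hG' : e' * (K' * G') * e' = e' * (K' * G'))
    (hinv : (K' * G') * (G * K) = 1) {A : R} (hA : F * A = -(e * F * e')) (heA : e * A = A) :
    e * (G * K * F) * e' = -(e * (G * K * F) * e * A) +
      e * (G * K) * e' * (K' * G') * (e' * (G * K * F) * e') := by
  have h₂ : e * (G * K * F) * e * A = -(e * (G * K) * e * F * e') := by
    calc e * (G * K * F) * e * A = e * (G * K) * (F * (e * A)) := by noncomm_ring
      _ = _ := by rw [heA, hA]; noncomm_ring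
  have h₃ : e * (G * K) * e' * (K' * G') * (e' * (G * K * F) * e') =
      e * (G * K) * (e' * (K' * G') * e') * (G * K) * F * e' := by noncomm_ring
  have h₄ : e * (G * K) * (e' * (K' * G')) * (G * K) * F * e' =
      e * (G * K) * e' * ((K' * G') * (G * K)) * F * e' := by noncomm_ring
  rw [h₂, h₃, hG', h₄, hinv, mul_one, neg_neg]
  calc e * (G * K * F) * e' = e * (G * K) * (e + e') * F * e' := by rw [h₁]; noncomm_ring
    _ = _ := by noncomm_ring

end Blocks

section MatrixBlocks

variable {P : Type*} [Fintype P] [DecidableEq P]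

open Classical in
/-- The diagonal idempotent matrix of a subset. -/
def projM (S : Set P) : Matrix P P ℂ[X] := Matrix.diagonal fun i => if i ∈ S then 1 else 0

variable {S T Y : Set P} {M N : Matrix P P ℂ[X]} {r : P → P → ℕ}

open Classical in
theorem projM_mul_mul_apply (i j : P) :
    (projM S * M * projM T) i j = if i ∈ S ∧ j ∈ T then M i j else 0 := by
  rw [projM, projM, Matrix.mul_diagonal, Matrix.diagonal_mul]
  by_cases h₁ : i ∈ S <;> by_cases h₂ : j ∈ T <;> simp [h₁, h₂]

omit [Fintype P] in
theorem projM_compl_add : projM Yᶜ + projM Y = 1 := by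
  rw [projM, projM, Matrix.diagonal_add, ← Matrix.diagonal_one]
  congr 1
  ext1 i
  by_cases h : i ∈ Y <;> simp [h]

theorem projM_mul_self : projM S * projM S = projM S := by
  rw [projM, Matrix.diagonal_mul_diagonal]
  congr 1
  ext1 i
  by_cases h : i ∈ S <;> simp [h]

theorem hatM_projM {ρ : P → ℤ} : hatM ρ (projM S) = projM S := hatM_diagonal _

theorem revM_projM_mul_mul : revM r (projM S * M * projM T) = projM S * revM r M * projM T := by
  ext1 i j
  rw [revM_apply, projM_mul_mul_apply, projM_mul_mul_apply, revM_apply]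
  split_ifs <;> simp

variable [PartialOrder P]

theorem IsBounded.projM_mul_mul (hM : IsBounded r M) : IsBounded r (projM S * M * projM T) where
  le i j h := by
    rw [projM_mul_mul_apply] at h
    split_ifs at h with h'
    · exact hM.le i j h
    · exact absurd rfl h
  deg i j := by
    rw [projM_mul_mul_apply]
    split_ifs
    · exact hM.deg i j
    · simp

theorem IsHalfBounded.projM_mul_mul (hM : IsHalfBounded r M) :
    IsHalfBounded r (projM S * M * projM T) where
  toIsBounded := hM.toIsBounded.projM_mul_mul
  half i j h := by
    rw [projM_mul_mul_apply]
    have := hM.half i j h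
    split_ifs
    · exact this
    · rw [natDegree_zero]; omega

theorem IsBounded.projM_mul (hM : IsBounded r M) (hY : IsUpperSet Y) :
    projM Y * M = projM Y * M * projM Y := by
  have h : projM Y * M * projM Yᶜ = 0 := by
    ext1 i j
    rw [projM_mul_mul_apply, Matrix.zero_apply]
    split_ifs with hij
    · exact hM.eq_zero fun hle => hij.2 (hY hle hij.1)
    · rfl
  calc projM Y * M = projM Y * M * (projM Yᶜ + projM Y) := by rw [projM_compl_add, mul_one]
    _ = _ := by rw [mul_add, h, zero_add]

theorem IsBounded.mul_projM_compl (hM : IsBounded r M) (hY : IsUpperSet Y) :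
    M * projM Yᶜ = projM Yᶜ * M * projM Yᶜ := by
  have h : projM Y * M * projM Yᶜ = 0 := by
    rw [hM.projM_mul hY, mul_assoc]
    have : projM Y * projM Yᶜ = (0 : Matrix P P ℂ[X]) := by
      have h₁ : projM Yᶜ = (1 : Matrix P P ℂ[X]) - projM Y := eq_sub_of_add_eq projM_compl_add
      rw [h₁, mul_sub, projM_mul_self, mul_one, sub_self]
    rw [this, mul_zero]
  calc M * projM Yᶜ = (projM Yᶜ + projM Y) * M * projM Yᶜ := by rw [projM_compl_add, one_mul]
    _ = _ := by rw [add_mul, add_mul, h, add_zero]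

/-- The operator `Δ` on matrices. -/
def deltaM (r : P → P → ℕ) (L : Matrix P P ℂ[X]) : Matrix P P ℂ[X] :=
  Matrix.of fun i j => if i = j then 0 else deltaPoly (r i j) (L i j)

omit [Fintype P] [PartialOrder P] in
theorem deltaM_apply (L : Matrix P P ℂ[X]) (i j : P) :
    deltaM r L i j = if i = j then 0 else deltaPoly (r i j) (L i j) := rfl

omit [PartialOrder P] in
theorem deltaM_hatM {ρ : P → ℤ} : deltaM r (hatM ρ M) = hatM ρ (deltaM r M) := by
  ext1 i j
  rw [deltaM_apply, hatM_apply, hatM_apply, deltaM_apply, deltaPoly_C_mul]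
  split_ifs <;> simp

omit [Fintype P] in
theorem IsBounded.deltaM (hM : IsBounded r M) : IsBounded r (deltaM r M) where
  le i j h := by
    rw [deltaM_apply] at h
    refine hM.le i j fun h' => h ?_
    rw [h', deltaPoly_zero, ite_self]
  deg i j := by
    rw [deltaM_apply]
    split_ifs
    · simp
    · exact natDegree_deltaPoly_le _ _

/-- A rank alternating multiplicative kernel together with its right and left
Kazhdan-Lusztig-Stanley functions, on the level of matrices. -/
structure IsKLSTriple (r : P → P → ℕ) (ρ : P → ℤ) (K F G : Matrix P P ℂ[X]) : Prop where
  weak : IsWeakRank r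
  bdd : IsBounded r K
  mul_hat : K * hatM ρ K = 1
  right : IsHalfBounded r F
  right_diag : ∀ i, F i i = 1
  right_rev : revM r F = K * F
  left : IsHalfBounded r G
  left_diag : ∀ i, G i i = 1
  left_rev : revM r G = G * K

namespace IsKLSTriple

variable {ρ : P → ℤ} {K F G J L : Matrix P P ℂ[X]}

theorem left_mul_hat (h : IsKLSTriple r ρ K F G) : G * hatM ρ F = 1 :=
  mul_hatM_eq_one_of_revM h.weak h.mul_hat h.right h.right_diag h.right_rev h.left h.left_diag
    h.left_rev

theorem hat_mul_left (h : IsKLSTriple r ρ K F G) : hatM ρ F * G = 1 :=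
  mul_eq_one_comm.1 h.left_mul_hat

theorem right_mul_hat (h : IsKLSTriple r ρ K F G) : F * hatM ρ G = 1 := by
  rw [← hatM_hatM (ρ := ρ) (M := F), ← hatM_mul, h.hat_mul_left, hatM_one]

theorem hat_mul_right (h : IsKLSTriple r ρ K F G) : hatM ρ G * F = 1 :=
  mul_eq_one_comm.1 h.right_mul_hat

theorem revM_hat_right (h : IsKLSTriple r ρ K F G) :
    revM r (hatM ρ F) = hatM ρ K * hatM ρ F := by
  rw [revM_hatM, h.right_rev, hatM_mul]

theorem revM_block (h : IsKLSTriple r ρ K F G) (S T : Set P) :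
    revM r (projM S * G * projM T * hatM ρ F) =
      projM S * (G * K) * projM T * (hatM ρ K * hatM ρ F) := by
  rw [revM_mul h.weak h.left.toIsBounded.projM_mul_mul h.right.toIsBounded.hatM,
    revM_projM_mul_mul, h.left_rev, h.revM_hat_right]

/-- `Δ ℓ = g|_{X/Y} g⁻¹`. -/
theorem deltaM_eq (h : IsKLSTriple r ρ K F G) (hY : IsUpperSet Y)
    (hJ : projM Yᶜ * J * projM Y = J) (hJK : J * (projM Y * K * projM Y) = projM Yᶜ * K * projM Y)
    (hL : (X - 1 : ℂ[X]) • L = G * J * hatM ρ F) :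
    deltaM r L = projM Yᶜ * G * projM Y * hatM ρ F := by
  have hJ' : J = projM Yᶜ * K * projM Y * hatM ρ K := by
    have hJe : J * projM Y = J := by
      calc J * projM Y = projM Yᶜ * J * (projM Y * projM Y) := by
            rw [← mul_assoc, hJ]
        _ = J := by rw [projM_mul_self, hJ]
    rw [← hJK, ← h.bdd.projM_mul hY, ← mul_assoc, hJe, mul_assoc, h.mul_hat, mul_one]
  have key := block_rev_sub projM_compl_add (h.left.toIsBounded.mul_projM_compl hY)
    (h.bdd.projM_mul hY) h.mul_hat hJ' (G' := hatM ρ F)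
  rw [← h.revM_block, ← hL] at key
  have ha : IsHalfBounded r (projM Yᶜ * G * projM Y * hatM ρ F) :=
    h.left.projM_mul_mul.mul h.weak h.right.hatM
  ext1 i j
  rw [deltaM_apply]
  split_ifs with hij
  · subst hij
    rw [(h.left.projM_mul_mul (S := Yᶜ) (T := Y)).mul_apply_self h.right.hatM.toIsBounded,
      projM_mul_mul_apply, if_neg fun h' => h'.1 h'.2, zero_mul]
  · have hkey := congrFun (congrFun key i) j
    rw [Matrix.sub_apply, revM_apply, Matrix.smul_apply, smul_eq_mul] at hkey
    by_cases hle : i ≤ j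
    · have hlt := lt_of_le_of_ne hle hij
      exact deltaPoly_eq_of_reflect_sub (h.weak.pos i j hlt) (ha.half i j hlt) hkey.symm
    · rw [ha.eq_zero hle, reflect_zero, sub_zero] at hkey
      have hX : (X - 1 : ℂ[X]) ≠ 0 := by simpa using X_sub_C_ne_zero (1 : ℂ)
      rw [(mul_eq_zero.1 hkey.symm).resolve_left hX, deltaPoly_zero, ha.eq_zero hle]

variable (h : IsKLSTriple r ρ K F G) (hY : IsUpperSet Y)
  (hL : deltaM r L = projM Yᶜ * G * projM Y * hatM ρ F)

include hL

omit [PartialOrder P] h in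
theorem deltaM_hat : deltaM r (hatM ρ L) = projM Yᶜ * hatM ρ G * projM Y * F := by
  rw [deltaM_hatM, hL, hatM_mul, hatM_mul, hatM_mul, hatM_projM, hatM_projM, hatM_hatM]

omit [PartialOrder P] h in
theorem projM_compl_mul_deltaM_hat : projM Yᶜ * deltaM r (hatM ρ L) = deltaM r (hatM ρ L) := by
  rw [deltaM_hat hL, ← mul_assoc, ← mul_assoc, ← mul_assoc, projM_mul_self]

include h

theorem deltaM_mul_left : deltaM r L * G = projM Yᶜ * G * projM Y := by
  rw [hL, mul_assoc, h.hat_mul_left, mul_one]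

include hY

theorem deltaM_mul_left_upper :
    deltaM r L * (projM Y * G * projM Y) = projM Yᶜ * G * projM Y := by
  have h₁ : deltaM r L * projM Y = deltaM r L := by
    rw [hL, mul_assoc _ (projM Y), h.right.hatM.toIsBounded.projM_mul hY]
    simp only [mul_assoc, projM_mul_self]
  rw [← h.left.toIsBounded.projM_mul hY, ← mul_assoc, h₁, h.deltaM_mul_left hL]

theorem right_mul_deltaM_hat :
    F * deltaM r (hatM ρ L) = -(projM Yᶜ * F * projM Y) := by
  rw [deltaM_hat hL]
  exact block_right projM_compl_add (h.right.toIsBounded.projM_mul hY)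
    (h.left.hatM.toIsBounded.projM_mul hY) h.right_mul_hat h.hat_mul_right

theorem right_lower_mul_deltaM_hat :
    projM Yᶜ * F * projM Yᶜ * deltaM r (hatM ρ L) = -(projM Yᶜ * F * projM Y) := by
  rw [← h.right.toIsBounded.mul_projM_compl hY, mul_assoc, projM_compl_mul_deltaM_hat hL,
    h.right_mul_deltaM_hat hY hL]

theorem Z_block :
    projM Yᶜ * (G * K * F) * projM Y =
      -(projM Yᶜ * (G * K * F) * projM Yᶜ * deltaM r (hatM ρ L)) +
        revM r (deltaM r L) * (projM Y * (G * K * F) * projM Y) := by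
  rw [hL, h.revM_block]
  refine block_Z projM_compl_add ?_ ?_ (h.right_mul_deltaM_hat hY hL)
    (projM_compl_mul_deltaM_hat hL)
  · exact ((h.bdd.hatM.mul h.weak h.right.hatM.toIsBounded).projM_mul hY).symm
  · rw [mul_assoc, ← mul_assoc (hatM ρ F), h.hat_mul_left, one_mul]
    exact mul_eq_one_comm.1 h.mul_hat

end IsKLSTriple

end MatrixBlocks

section Transfer

variable {W B : Type*} [Group W] [MulAction W B]

instance fixedByFintype [Finite B] (w : W) : Fintype (MulAction.fixedBy B w) := Fintype.ofFinite _

instance fixedByDecidableEq (w : W) : DecidableEq (MulAction.fixedBy B w) := Classical.decEq _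

/-- The restriction of a weak rank function to the elements fixed by `w`. -/
def fixedRank (r : B → B → ℕ) (w : W) (i j : MulAction.fixedBy B w) : ℕ := r i j

variable [PartialOrder B]

theorem IsWeakRank.fixedRank {r : B → B → ℕ} (hr : IsWeakRank r) (w : W) :
    IsWeakRank (fixedRank r w) where
  pos i j h := hr.pos i j h
  add i k j h h' := hr.add i k j h h'

/-- The evaluation of an element of the equivariant incidence algebra at `w`, as a matrix indexed
by the elements fixed by `w`. -/
def mat (p : IncFun W B) (w : W) :
    Matrix (MulAction.fixedBy B w) (MulAction.fixedBy B w) ℂ[X] :=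
  Matrix.of fun i j => evFun p w i j

variable {p p' : IncFun W B} {r : B → B → ℕ} {w : W}

theorem mat_apply (i j : MulAction.fixedBy B w) : mat p w i j = evFun p w i j := rfl

theorem mat_apply_of_le {i j : MulAction.fixedBy B w} (h : (i : B) ≤ j) :
    mat p w i j = (p i j h).map (RepRing.ev (⟨w, i.2, j.2⟩ : stab₂ W (i : B) (j : B))) :=
  evFun_eq p h i.2 j.2

theorem mat_apply_of_not_le {i j : MulAction.fixedBy B w} (h : ¬ i ≤ j) : mat p w i j = 0 :=
  evFun_of_not p fun H => h H.1

theorem ext_mat [Finite W] (h : ∀ w, mat p w = mat p' w) : p = p' :=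
  IncFun.ext_evFun fun w z z' => by
    by_cases H : z ≤ z' ∧ w • z = z ∧ w • z' = z'
    · exact congrFun (congrFun (h w) ⟨z, H.2.1⟩) ⟨z', H.2.2⟩
    · rw [evFun_of_not _ H, evFun_of_not _ H]

/-! ### Equivariance -/

theorem isEquivariant_of_evFun_eq [Finite W] (hm : IsMonoAction W B) (hp : IsEquivariant p)
    (T : B → B → ℂ[X] → ℂ[X]) (hT₀ : ∀ z z', T z z' 0 = 0)
    (hT : ∀ (x : W) z z' a, z ≤ z' → T (x • z) (x • z') a = T z z' a)
    (h : ∀ w z z', evFun p' w z z' = T z z' (evFun p w z z')) : IsEquivariant p' := by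
  refine isEquivariant_of_evFun_conj fun x w z z' => ?_
  rw [h, h, hp.evFun_conj hm]
  by_cases hle : z ≤ z'
  · exact hT x z z' _ hle
  · rw [evFun_of_not p fun H => hle H.1, hT₀, hT₀]

theorem evFun_of_map (T : B → B → ℂ[X] → ℂ[X]) (hT₀ : ∀ z z', T z z' 0 = 0)
    (h : ∀ z z' (hz : z ≤ z') (g : stab₂ W z z'),
      (p' z z' hz).map (RepRing.ev g) = T z z' ((p z z' hz).map (RepRing.ev g))) (w : W) (z z' : B) :
    evFun p' w z z' = T z z' (evFun p w z z') := by
  by_cases H : z ≤ z' ∧ w • z = z ∧ w • z' = z'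
  · rw [evFun_eq _ H.1 H.2.1 H.2.2, evFun_eq _ H.1 H.2.1 H.2.2]
    exact h _ _ _ _
  · rw [evFun_of_not _ H, evFun_of_not _ H, hT₀]

open Classical in
theorem evFun_one (w : W) (z z' : B) :
    evFun (1 : IncFun W B) w z z' = if z = z' ∧ w • z = z then 1 else 0 := by
  split_ifs with h
  · obtain ⟨rfl, h⟩ := h
    rw [evFun_eq _ le_rfl h h, evAt]
    change Polynomial.map _ (if z = z then 1 else 0) = 1
    rw [if_pos rfl, Polynomial.map_one]
  · by_cases H : z ≤ z' ∧ w • z = z ∧ w • z' = z'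
    · rw [evFun_eq _ H.1 H.2.1 H.2.2, evAt]
      change Polynomial.map _ (if z = z' then 1 else 0) = 0
      rw [if_neg fun hz => h ⟨hz, H.2.1⟩, Polynomial.map_zero]
    · exact evFun_of_not _ H

theorem evFun_add (w : W) (z z' : B) :
    evFun (p + p') w z z' = evFun p w z z' + evFun p' w z z' := by
  by_cases H : z ≤ z' ∧ w • z = z ∧ w • z' = z'
  · rw [evFun_eq _ H.1 H.2.1 H.2.2, evFun_eq _ H.1 H.2.1 H.2.2, evFun_eq _ H.1 H.2.1 H.2.2]
    exact Polynomial.map_add _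
  · rw [evFun_of_not _ H, evFun_of_not _ H, evFun_of_not _ H, add_zero]

theorem evFun_neg (w : W) (z z' : B) : evFun (-p) w z z' = -evFun p w z z' :=
  evFun_of_map (fun _ _ => Neg.neg) (fun _ _ => neg_zero) (fun _ _ _ _ => Polynomial.map_neg _)
    w z z'

theorem evFun_smul (a : ℤ[X]) (w : W) (z z' : B) :
    evFun (a • p) w z z' = a.map (Int.castRingHom ℂ) * evFun p w z z' :=
  evFun_of_map (fun _ _ b => a.map (Int.castRingHom ℂ) * b) (fun _ _ => mul_zero _)
    (fun z z' hz g => by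
      change (a.map (Int.castRingHom _) * p z z' hz).map _ = _
      rw [Polynomial.map_mul, Polynomial.map_map]
      congr 2
      exact RingHom.ext_int _ _) w z z'

theorem evFun_rev (w : W) (z z' : B) :
    evFun (rev r p) w z z' = (evFun p w z z').reflect (r z z') :=
  evFun_of_map (fun z z' a => a.reflect (r z z')) (fun _ _ => reflect_zero)
    (fun _ _ _ _ => (reflect_map _ _ _).symm) w z z'

open Classical in
theorem evFun_restrict (S : B → B → Prop) (w : W) (z z' : B) :
    evFun (restrict S p) w z z' = if S z z' then evFun p w z z' else 0 :=
  evFun_of_map (fun z z' a => if S z z' then a else 0) (fun _ _ => ite_self _)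
    (fun z z' hz g => by
      change Polynomial.map _ (if S z z' then _ else _) = _
      split_ifs <;> simp) w z z'

open Classical in
theorem evFun_Delta (w : W) (z z' : B) :
    evFun (Delta r p) w z z' = if z = z' then 0 else deltaPoly (r z z') (evFun p w z z') :=
  evFun_of_map (fun z z' a => if z = z' then 0 else deltaPoly (r z z') a)
    (fun _ _ => by rw [deltaPoly_zero, ite_self])
    (fun z z' hz g => by
      change Polynomial.map _ (if z = z' then _ else deltaPoly _ _) = _
      split_ifs
      · simp
      · rw [map_deltaPoly]) w z z'

theorem isEquivariant_one [Finite W] : IsEquivariant (1 : IncFun W B) := by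
  classical
  refine isEquivariant_of_evFun_conj fun x w z z' => ?_
  rw [evFun_one, evFun_one, ← mul_smul, inv_mul_cancel_right, mul_smul, smul_left_cancel_iff,
    smul_left_cancel_iff]

theorem IsEquivariant.mul [Finite W] [Finite B] (hm : IsMonoAction W B) (hp : IsEquivariant p)
    (hp' : IsEquivariant p') : IsEquivariant (p * p') := by
  cases nonempty_fintype B
  refine isEquivariant_of_evFun_conj fun x w z z' => ?_
  rw [evFun_mul hm hp hp', evFun_mul hm hp hp']
  refine (Fintype.sum_equiv (MulAction.toPerm x) _ _ fun b => ?_).symm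
  rw [MulAction.toPerm_apply, hp.evFun_conj hm, hp'.evFun_conj hm]

theorem IsEquivariant.add [Finite W] (hm : IsMonoAction W B) (hp : IsEquivariant p)
    (hp' : IsEquivariant p') : IsEquivariant (p + p') :=
  isEquivariant_of_evFun_conj fun x w z z' => by
    rw [evFun_add, evFun_add, hp.evFun_conj hm, hp'.evFun_conj hm]

theorem IsEquivariant.neg [Finite W] (hm : IsMonoAction W B) (hp : IsEquivariant p) :
    IsEquivariant (-p) :=
  isEquivariant_of_evFun_eq hm hp (fun _ _ => Neg.neg) (fun _ _ => neg_zero)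
    (fun _ _ _ _ _ => rfl) evFun_neg

theorem IsEquivariant.rev [Finite W] (hm : IsMonoAction W B) (hp : IsEquivariant p)
    (hr : IsInvariantRank W r) : IsEquivariant (rev r p) :=
  isEquivariant_of_evFun_eq hm hp (fun z z' a => a.reflect (r z z')) (fun _ _ => reflect_zero)
    (fun x z z' a h => by rw [hr x z z' h]) evFun_rev

theorem IsEquivariant.restrict [Finite W] (hm : IsMonoAction W B) (hp : IsEquivariant p)
    {S : B → B → Prop} (hS : ∀ (x : W) z z', S (x • z) (x • z') ↔ S z z') :
    IsEquivariant (restrict S p) := by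
  classical
  exact isEquivariant_of_evFun_eq hm hp (fun z z' a => if S z z' then a else 0)
    (fun _ _ => ite_self _) (fun x z z' a _ => by rw [hS]) (evFun_restrict S)

theorem IsEquivariant.Delta [Finite W] (hm : IsMonoAction W B) (hp : IsEquivariant p)
    (hr : IsInvariantRank W r) : IsEquivariant (Delta r p) := by
  classical
  exact isEquivariant_of_evFun_eq hm hp
    (fun z z' a => if z = z' then 0 else deltaPoly (r z z') a)
    (fun _ _ => by rw [deltaPoly_zero, ite_self])
    (fun x z z' a h => by simp only [smul_left_cancel_iff, hr x z z' h]) evFun_Delta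

/-! ### Evaluation of the operations -/

theorem mat_mul [Finite W] [Finite B] (hm : IsMonoAction W B) (hp : IsEquivariant p)
    (hp' : IsEquivariant p') : mat (p * p') w = mat p w * mat p' w := by
  classical
  cases nonempty_fintype B
  ext1 i j
  rw [mat_apply, evFun_mul hm hp hp', Matrix.mul_apply]
  refine (Finset.sum_of_injOn Subtype.val Subtype.val_injective.injOn (fun _ _ => Finset.mem_univ _)
    (fun b _ hb => ?_) fun _ _ => rfl).symm
  rw [evFun_of_not p fun H => hb ⟨⟨b, H.2.2⟩, Finset.mem_coe.2 (Finset.mem_univ _), rfl⟩, zero_mul]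

theorem mat_one : mat (1 : IncFun W B) w = 1 := by
  classical
  ext1 i j
  rw [mat_apply, evFun_one, Matrix.one_apply]
  have hi : w • (i : B) = i := i.2
  simp [hi, Subtype.ext_iff]

theorem mat_add : mat (p + p') w = mat p w + mat p' w :=
  Matrix.ext fun _ _ => evFun_add _ _ _

theorem mat_neg : mat (-p) w = -mat p w := Matrix.ext fun _ _ => evFun_neg _ _ _

theorem mat_smul : mat ((X - 1 : ℤ[X]) • p) w = (X - 1 : ℂ[X]) • mat p w :=
  Matrix.ext fun i j => by
    rw [mat_apply, evFun_smul, Matrix.smul_apply, smul_eq_mul, mat_apply]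
    simp

theorem mat_rev : mat (rev r p) w = revM (fixedRank r w) (mat p w) :=
  Matrix.ext fun _ _ => evFun_rev _ _ _

theorem mat_Delta : mat (Delta r p) w = deltaM (fixedRank r w) (mat p w) :=
  Matrix.ext fun i j => by
    classical
    rw [mat_apply, evFun_Delta, deltaM_apply, ← mat_apply]
    simp only [Subtype.ext_iff]
    rfl

theorem mat_restrict [Finite B] (S T : Set B) :
    mat (restrict (fun z z' => z ∈ S ∧ z' ∈ T) p) w =
      projM (Subtype.val ⁻¹' S) * mat p w * projM (Subtype.val ⁻¹' T) :=
  Matrix.ext fun i j => by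
    classical
    rw [mat_apply, evFun_restrict, projM_mul_mul_apply]
    simp only [Set.mem_preimage, mat_apply]
    congr

/-! ### Membership -/

theorem natDegree_le_of_ev {G : Type*} [Group G] [Finite G] {a : (RepRing G)[X]} {n : ℕ}
    (h : ∀ g, (a.map (RepRing.ev g)).natDegree ≤ n) : a.natDegree ≤ n := by
  rw [natDegree_le_iff_coeff_eq_zero]
  intro N hN
  refine RepRing.ext_ev fun g => ?_
  rw [← coeff_map, map_zero]
  exact coeff_eq_zero_of_natDegree_lt ((h g).trans_lt hN)

theorem mem_II_iff [Finite W] :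
    p ∈ II r ↔ IsEquivariant p ∧ ∀ w, IsBounded (fixedRank r w) (mat p w) := by
  refine ⟨fun h => ⟨h.1, fun w => ⟨fun i j hij => ?_, fun i j => ?_⟩⟩, fun h => ⟨h.1, ?_⟩⟩
  · by_contra hle
    exact hij (mat_apply_of_not_le hle)
  · by_cases hle : i ≤ j
    · rw [mat_apply_of_le hle]
      exact natDegree_map_le.trans (h.2 _ _ _)
    · rw [mat_apply_of_not_le hle, natDegree_zero]
      exact Nat.zero_le _
  · intro z z' hz
    refine natDegree_le_of_ev fun g => ?_
    have := (h.2 g).deg ⟨z, g.2.1⟩ ⟨z', g.2.2⟩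
    rwa [mat_apply_of_le (i := ⟨z, g.2.1⟩) (j := ⟨z', g.2.2⟩) hz] at this

theorem mem_IIHalf_iff [Finite W] (hr : IsWeakRank r) :
    p ∈ IIHalf r ↔ IsEquivariant p ∧ ∀ w, IsHalfBounded (fixedRank r w) (mat p w) := by
  refine ⟨fun h => ⟨h.1.1, fun w => ⟨(mem_II_iff.1 h.1).2 w, fun i j hij => ?_⟩⟩,
    fun h => ⟨mem_II_iff.2 ⟨h.1, fun w => (h.2 w).toIsBounded⟩, fun z z' hz => ?_⟩⟩
  · have h₁ := h.2 i j hij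
    have h₂ : (mat p w i j).natDegree ≤ (p i j hij.le).natDegree := by
      rw [mat_apply_of_le hij.le]
      exact natDegree_map_le
    exact lt_of_le_of_lt (by omega) h₁
  · have hpos := hr.pos z z' hz
    suffices h' : (p z z' hz.le).natDegree ≤ (r z z' - 1) / 2 by omega
    refine natDegree_le_of_ev fun g => ?_
    have h₁ : _ < r z z' := (h.2 g).half ⟨z, g.2.1⟩ ⟨z', g.2.2⟩ hz
    rw [mat_apply_of_le (i := ⟨z, g.2.1⟩) (j := ⟨z', g.2.2⟩) hz.le] at h₁
    change 2 * ((p z z' hz.le).map (RepRing.ev g)).natDegree < r z z' at h₁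
    omega

theorem mem_UU_iff [Finite W] :
    p ∈ UU W B ↔ IsEquivariant p ∧ ∀ w i, mat p w i i = 1 := by
  refine ⟨fun h => ⟨h.1, fun w i => ?_⟩, fun h => ⟨h.1, fun z => ?_⟩⟩
  · rw [mat_apply_of_le le_rfl, h.2, Polynomial.map_one]
  · refine RepRing.polynomial_ext_ev fun g => ?_
    have := h.2 g ⟨z, g.2.1⟩
    rw [mat_apply_of_le (i := ⟨z, g.2.1⟩) (j := ⟨z, g.2.1⟩) le_rfl] at this
    rw [Polynomial.map_one]
    exact this

theorem isHat_iff [Finite B] : IsHat p p' ↔ ∀ (w : W) (ρ : MulAction.fixedBy B w → ℤ),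
    IsRankFunction ρ → mat p' w = hatM ρ (mat p w) := by
  refine ⟨fun h w ρ hρ => Matrix.ext fun i j => ?_, fun h w ρ hρ z z' hz => ?_⟩
  · rw [hatM_apply]
    by_cases hle : i ≤ j
    · rw [mat_apply, evFun_eq p' hle i.2 j.2, mat_apply, evFun_eq p hle i.2 j.2]
      exact h w ρ hρ i j hle
    · rw [mat_apply_of_not_le hle, mat_apply_of_not_le hle, mul_zero]
  · have := congrFun (congrFun (h w ρ hρ) z) z'
    rwa [hatM_apply, mat_apply, evFun_eq p' hz z.2 z'.2, mat_apply, evFun_eq p hz z.2 z'.2] at this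

end Transfer

section MatrixRecursion

theorem smul_mat_cancel {P : Type*} {M N : Matrix P P ℂ[X]}
    (h : (X - 1 : ℂ[X]) • M = (X - 1 : ℂ[X]) • N) : M = N := by
  have hX : (X - 1 : ℂ[X]) ≠ 0 := by simpa using X_sub_C_ne_zero (1 : ℂ)
  ext1 i j
  have := congrFun (congrFun h i) j
  rw [Matrix.smul_apply, Matrix.smul_apply, smul_eq_mul, smul_eq_mul] at this
  exact mul_left_cancel₀ hX this

variable {P : Type*} [PartialOrder P] [Fintype P] [DecidableEq P] {r : P → P → ℕ}
  {K M N : Matrix P P ℂ[X]}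

/-- The entries of `K M - M`, for unitriangular `K`, only depend on the entries of `M` at smaller
intervals. -/
theorem mul_sub_self_congr (hr : IsWeakRank r) (hK : ∀ i j, ¬ i ≤ j → K i j = 0)
    (hK₁ : ∀ i, K i i = 1) (hM : ∀ i j, ¬ i ≤ j → M i j = 0) (hN : ∀ i j, ¬ i ≤ j → N i j = 0)
    {n : ℕ} (h : ∀ i j, r i j < n → M i j = N i j) (i j : P) (hij : r i j < n + 1) :
    (K * M - M) i j = (K * N - N) i j := by
  have e : (K * M - M) - (K * N - N) = (K - 1) * (M - N) := by noncomm_ring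
  rw [← sub_eq_zero, ← Matrix.sub_apply, e, Matrix.mul_apply]
  refine Finset.sum_eq_zero fun k _ => ?_
  by_cases hik : i = k
  · subst hik
    rw [Matrix.sub_apply, hK₁, Matrix.one_apply_eq, sub_self, zero_mul]
  by_cases hle : i ≤ k
  · by_cases hkj : k ≤ j
    · have h₁ := hr.add i k j hle hkj
      have h₂ := hr.pos i k (lt_of_le_of_ne hle hik)
      rw [Matrix.sub_apply M, h k j (by omega), sub_self, mul_zero]
    · rw [Matrix.sub_apply M, hM k j hkj, hN k j hkj, sub_self, mul_zero]
  · rw [Matrix.sub_apply, hK i k hle, Matrix.one_apply_ne hik, sub_self, zero_mul]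

/-- The entries of `M K - M`, for unitriangular `K`, only depend on the entries of `M` at smaller
intervals. -/
theorem mul_sub_self_congr' (hr : IsWeakRank r) (hK : ∀ i j, ¬ i ≤ j → K i j = 0)
    (hK₁ : ∀ i, K i i = 1) (hM : ∀ i j, ¬ i ≤ j → M i j = 0) (hN : ∀ i j, ¬ i ≤ j → N i j = 0)
    {n : ℕ} (h : ∀ i j, r i j < n → M i j = N i j) (i j : P) (hij : r i j < n + 1) :
    (M * K - M) i j = (N * K - N) i j := by
  have e : (M * K - M) - (N * K - N) = (M - N) * (K - 1) := by noncomm_ring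
  rw [← sub_eq_zero, ← Matrix.sub_apply, e, Matrix.mul_apply]
  refine Finset.sum_eq_zero fun k _ => ?_
  by_cases hkj : k = j
  · subst hkj
    rw [Matrix.sub_apply K, hK₁, Matrix.one_apply_eq, sub_self, mul_zero]
  by_cases hle : k ≤ j
  · by_cases hik : i ≤ k
    · have h₁ := hr.add i k j hik hle
      have h₂ := hr.pos k j (lt_of_le_of_ne hle hkj)
      rw [Matrix.sub_apply, h i k (by omega), sub_self, zero_mul]
    · rw [Matrix.sub_apply, hM i k hik, hN i k hik, sub_self, zero_mul]
  · rw [Matrix.sub_apply K, hK k j hle, Matrix.one_apply_ne hkj, sub_self, mul_zero]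

end MatrixRecursion

section Existence

variable {W B : Type*} [Group W] [MulAction W B] [PartialOrder B]

/-- Two elements of the incidence algebra agree on the intervals of rank less than `n`. -/
def AgreeBelow (r : B → B → ℕ) (n : ℕ) (p p' : IncFun W B) : Prop :=
  ∀ (w : W) (i j : MulAction.fixedBy B w), fixedRank r w i j < n → mat p w i j = mat p' w i j

/-- Operators for which the value on an interval only depends on the values on intervals of smaller
rank have fixed points. -/
theorem exists_fixedPoint [Finite W] [Finite B] (r : B → B → ℕ) {S : Set (IncFun W B)}
    (T : IncFun W B → IncFun W B) (hS : S.Nonempty) (hTS : ∀ p ∈ S, T p ∈ S)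
    (hT : ∀ n, ∀ p ∈ S, ∀ p' ∈ S, AgreeBelow r n p p' → AgreeBelow r (n + 1) (T p) (T p')) :
    ∃ p ∈ S, T p = p := by
  obtain ⟨p₀, h₀⟩ := hS
  have hmem : ∀ n, T^[n] p₀ ∈ S := fun n => by
    induction n with
    | zero => exact h₀
    | succ n ih => rw [Function.iterate_succ_apply']; exact hTS _ ih
  have hagree : ∀ n, AgreeBelow r n (T^[n + 1] p₀) (T^[n] p₀) := fun n => by
    induction n with
    | zero => exact fun _ _ _ h => absurd h (Nat.not_lt_zero _)
    | succ n ih =>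
      have := hT n _ (hmem (n + 1)) _ (hmem n) ih
      rwa [← Function.iterate_succ_apply' T, ← Function.iterate_succ_apply' T] at this
  obtain ⟨N, hN⟩ := Set.Finite.bddAbove (Set.finite_range fun z : B × B => r z.1 z.2)
  refine ⟨T^[N + 1] p₀, hmem _, ext_mat fun w => Matrix.ext fun i j => ?_⟩
  rw [← Function.iterate_succ_apply' T]
  exact hagree (N + 1) w i j (Nat.lt_succ_of_le (hN ⟨(i, j), rfl⟩))

variable {r : B → B → ℕ} {κ p p' : IncFun W B}

theorem agreeBelow_mul_sub_self [Finite W] [Finite B] (hm : IsMonoAction W B) (hr : IsWeakRank r)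
    (hκ : κ ∈ UU W B) (hp : IsEquivariant p) (hp' : IsEquivariant p') {n : ℕ}
    (h : AgreeBelow r n p p') : AgreeBelow r (n + 1) (κ * p + -p) (κ * p' + -p') := by
  intro w i j hij
  rw [mat_add, mat_add, mat_neg, mat_neg, mat_mul hm hκ.1 hp, mat_mul hm hκ.1 hp',
    ← sub_eq_add_neg, ← sub_eq_add_neg]
  exact mul_sub_self_congr (hr.fixedRank w) (fun _ _ => mat_apply_of_not_le)
    ((mem_UU_iff.1 hκ).2 w) (fun _ _ => mat_apply_of_not_le) (fun _ _ => mat_apply_of_not_le)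
    (h w) i j hij

theorem agreeBelow_mul_sub_self' [Finite W] [Finite B] (hm : IsMonoAction W B) (hr : IsWeakRank r)
    (hκ : κ ∈ UU W B) (hp : IsEquivariant p) (hp' : IsEquivariant p') {n : ℕ}
    (h : AgreeBelow r n p p') : AgreeBelow r (n + 1) (p * κ + -p) (p' * κ + -p') := by
  intro w i j hij
  rw [mat_add, mat_add, mat_neg, mat_neg, mat_mul hm hp hκ.1, mat_mul hm hp' hκ.1,
    ← sub_eq_add_neg, ← sub_eq_add_neg]
  exact mul_sub_self_congr' (hr.fixedRank w) (fun _ _ => mat_apply_of_not_le)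
    ((mem_UU_iff.1 hκ).2 w) (fun _ _ => mat_apply_of_not_le) (fun _ _ => mat_apply_of_not_le)
    (h w) i j hij

/-! ### Inverses -/

theorem exists_isInverse [Finite W] [Finite B] (hm : IsMonoAction W B) (hr : IsWeakRank r)
    (hκ : κ ∈ UU W B) : ∃ p, IsInverse κ p := by
  obtain ⟨p, hp, hfix⟩ := exists_fixedPoint r (S := {p | IsEquivariant p})
    (fun p => 1 + -(κ * p + -p)) ⟨1, isEquivariant_one⟩
    (fun p hp => isEquivariant_one.add hm (((hκ.1.mul hm hp).add hm (hp.neg hm)).neg hm))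
    fun n p hp p' hp' h w i j hij => by
      rw [mat_add, mat_add, mat_neg, mat_neg, Matrix.add_apply, Matrix.add_apply, Matrix.neg_apply,
        Matrix.neg_apply, agreeBelow_mul_sub_self hm hr hκ hp hp' h w i j hij]
  have hmul : ∀ w, mat κ w * mat p w = 1 := fun w => by
    have := congrArg (fun p => mat p w) hfix
    simp only [mat_add, mat_neg, mat_mul hm hκ.1 hp, mat_one] at this
    rw [neg_add, neg_neg, ← add_assoc, add_eq_right, ← sub_eq_add_neg, sub_eq_zero] at this
    exact this.symm
  refine ⟨p, hp, ext_mat fun w => ?_, ext_mat fun w => ?_⟩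
  · rw [mat_mul hm hκ.1 hp, hmul, mat_one]
  · rw [mat_mul hm hp hκ.1, mul_eq_one_comm.1 (hmul w), mat_one]

theorem IsInverse.mat_mul [Finite W] [Finite B] (hm : IsMonoAction W B) (hκ : IsEquivariant κ)
    (h : IsInverse κ p) (w : W) : mat κ w * mat p w = 1 := by
  rw [← EquivKLS.mat_mul hm hκ h.1, h.2.1, mat_one]

theorem IsInverse.mat_eq [Finite W] [Finite B] (hm : IsMonoAction W B) (hκ : IsEquivariant κ)
    (h : IsInverse κ p) {w : W} {M : Matrix (MulAction.fixedBy B w) (MulAction.fixedBy B w) ℂ[X]}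
    (hM : mat κ w * M = 1) : mat p w = M :=
  left_inv_eq_right_inv (mul_eq_one_comm.1 (h.mat_mul hm hκ w)) hM

theorem existsUnique_isInverse [Finite W] [Finite B] (hm : IsMonoAction W B) (hr : IsWeakRank r)
    (hκ : κ ∈ UU W B) : ∃! p, IsInverse κ p := by
  obtain ⟨p, hp⟩ := exists_isInverse hm hr hκ
  exact ⟨p, hp, fun p' hp' => ext_mat fun w => hp'.mat_eq hm hκ.1 (hp.mat_mul hm hκ.1 w)⟩

/-! ### Kazhdan-Lusztig-Stanley functions -/

open Classical in
/-- The negative of the truncation to degrees less than `r / 2`, off the diagonal. -/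
def negTrunc (r : B → B → ℕ) (p : IncFun W B) : IncFun W B :=
  fun z z' h => if z = z' then 0 else -truncHalf (r z z') (p z z' h)

open Classical in
theorem evFun_negTrunc (w : W) (z z' : B) : evFun (negTrunc r p) w z z' =
    if z = z' then 0 else -truncHalf (r z z') (evFun p w z z') :=
  evFun_of_map (fun z z' a => if z = z' then 0 else -truncHalf (r z z') a)
    (fun _ _ => by rw [truncHalf_zero, neg_zero, ite_self])
    (fun z z' hz g => by
      rw [negTrunc]
      split_ifs
      · simp
      · rw [Polynomial.map_neg, map_truncHalf]) w z z'

theorem IsEquivariant.negTrunc [Finite W] (hm : IsMonoAction W B) (hp : IsEquivariant p)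
    (hr : IsInvariantRank W r) : IsEquivariant (negTrunc r p) := by
  classical
  exact isEquivariant_of_evFun_eq hm hp
    (fun z z' a => if z = z' then 0 else -truncHalf (r z z') a)
    (fun _ _ => by rw [truncHalf_zero, neg_zero, ite_self])
    (fun x z z' a h => by simp only [smul_left_cancel_iff, hr x z z' h]) evFun_negTrunc

theorem mat_one_add_negTrunc {w : W} (i j : MulAction.fixedBy B w) :
    mat (1 + negTrunc r p) w i j =
      if i = j then 1 else -truncHalf (fixedRank r w i j) (mat p w i j) := by
  rw [mat_add, mat_one, Matrix.add_apply, mat_apply, evFun_negTrunc]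
  by_cases h : i = j
  · subst h
    simp
  · rw [Matrix.one_apply_ne h, if_neg fun h' => h (Subtype.ext h'), if_neg h, zero_add]
    rfl

theorem isHalfBounded_of_recursion (hr : IsWeakRank r) {w : W}
    {Q : Matrix (MulAction.fixedBy B w) (MulAction.fixedBy B w) ℂ[X]}
    (h : ∀ i j, mat p w i j = if i = j then 1 else -truncHalf (fixedRank r w i j) (Q i j)) :
    IsHalfBounded (fixedRank r w) (mat p w) := by
  have half : ∀ i j, i < j → 2 * (mat p w i j).natDegree < fixedRank r w i j := fun i j hij => by
    rw [h, if_neg hij.ne, natDegree_neg]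
    exact two_mul_natDegree_truncHalf_lt (hr.pos i j hij) _
  refine ⟨⟨fun i j hij => ?_, fun i j => ?_⟩, half⟩
  · by_contra hle
    exact hij (mat_apply_of_not_le hle)
  · by_cases hle : i ≤ j
    · rcases hle.eq_or_lt with rfl | hlt
      · simp [h]
      · have := half i j hlt
        omega
    · rw [mat_apply_of_not_le hle, natDegree_zero]
      exact Nat.zero_le _

theorem exists_isRightKLS [Finite W] [Finite B] (hm : IsMonoAction W B) (hr : IsWeakRank r)
    (hrW : IsInvariantRank W r) (hκ : κ ∈ II r) (hκU : κ ∈ UU W B)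
    (hinv : ∀ w, revM (fixedRank r w) (mat κ w) * mat κ w = 1) : ∃ f, IsRightKLS r κ f := by
  have heq : ∀ p : IncFun W B, IsEquivariant p → IsEquivariant (κ * p + -p) :=
    fun p hp => (hκ.1.mul hm hp).add hm (hp.neg hm)
  obtain ⟨f, hf, hfix⟩ := exists_fixedPoint r (S := {p | IsEquivariant p})
    (fun p => 1 + negTrunc r (κ * p + -p)) ⟨1, isEquivariant_one⟩
    (fun p hp => isEquivariant_one.add hm ((heq p hp).negTrunc hm hrW))
    fun n p hp p' hp' h w i j hij => by
      rw [mat_one_add_negTrunc, mat_one_add_negTrunc,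
        agreeBelow_mul_sub_self hm hr hκU hp hp' h w i j hij]
  have hrec : ∀ w i j, mat f w i j = if i = j then 1 else
      -truncHalf (fixedRank r w i j) ((mat κ w * mat f w - mat f w) i j) := fun w i j => by
    have := congrArg (fun p => mat p w i j) hfix
    simp only [mat_one_add_negTrunc, mat_add, mat_neg, mat_mul hm hκ.1 hf, ← sub_eq_add_neg] at this
    exact this.symm
  have hhalf := fun w => isHalfBounded_of_recursion hr (hrec w)
  refine ⟨f, (mem_IIHalf_iff hr).2 ⟨hf, hhalf⟩,
    mem_UU_iff.2 ⟨hf, fun w i => by rw [hrec, if_pos rfl]⟩, ext_mat fun w => ?_⟩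
  rw [mat_rev, mat_mul hm hκ.1 hf]
  exact revM_eq_mul_of_recursion (hr.fixedRank w) ((mem_II_iff.1 hκ).2 w) ((mem_UU_iff.1 hκU).2 w)
    (hinv w) (hhalf w).toIsBounded (hrec w)

theorem exists_isLeftKLS [Finite W] [Finite B] (hm : IsMonoAction W B) (hr : IsWeakRank r)
    (hrW : IsInvariantRank W r) (hκ : κ ∈ II r) (hκU : κ ∈ UU W B)
    (hinv : ∀ w, mat κ w * revM (fixedRank r w) (mat κ w) = 1) : ∃ g, IsLeftKLS r κ g := by
  have heq : ∀ p : IncFun W B, IsEquivariant p → IsEquivariant (p * κ + -p) :=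
    fun p hp => (hp.mul hm hκ.1).add hm (hp.neg hm)
  obtain ⟨g, hg, hfix⟩ := exists_fixedPoint r (S := {p | IsEquivariant p})
    (fun p => 1 + negTrunc r (p * κ + -p)) ⟨1, isEquivariant_one⟩
    (fun p hp => isEquivariant_one.add hm ((heq p hp).negTrunc hm hrW))
    fun n p hp p' hp' h w i j hij => by
      rw [mat_one_add_negTrunc, mat_one_add_negTrunc,
        agreeBelow_mul_sub_self' hm hr hκU hp hp' h w i j hij]
  have hrec : ∀ w i j, mat g w i j = if i = j then 1 else
      -truncHalf (fixedRank r w i j) ((mat g w * mat κ w - mat g w) i j) := fun w i j => by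
    have := congrArg (fun p => mat p w i j) hfix
    simp only [mat_one_add_negTrunc, mat_add, mat_neg, mat_mul hm hg hκ.1, ← sub_eq_add_neg] at this
    exact this.symm
  have hhalf := fun w => isHalfBounded_of_recursion hr (hrec w)
  refine ⟨g, (mem_IIHalf_iff hr).2 ⟨hg, hhalf⟩,
    mem_UU_iff.2 ⟨hg, fun w i => by rw [hrec, if_pos rfl]⟩, ext_mat fun w => ?_⟩
  rw [mat_rev, mat_mul hm hg hκ.1]
  exact revM_eq_mul_of_recursion' (hr.fixedRank w) ((mem_II_iff.1 hκ).2 w) ((mem_UU_iff.1 hκU).2 w)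
    (hinv w) (hhalf w).toIsBounded (hrec w)

/-! ### Division by `t - 1` -/

/-- Division by `t - 1`. -/
def divXSubOne (p : IncFun W B) : IncFun W B := fun z z' h => p z z' h /ₘ (X - C 1)

theorem evFun_divXSubOne (w : W) (z z' : B) :
    evFun (divXSubOne p) w z z' = evFun p w z z' /ₘ (X - C 1) :=
  evFun_of_map (fun _ _ a => a /ₘ (X - C 1)) (fun _ _ => zero_divByMonic _)
    (fun z z' hz g => by
      rw [divXSubOne, map_divByMonic _ (monic_X_sub_C _)]
      simp) w z z'

/-- Elements which vanish at `t = 1` are uniquely divisible by `t - 1`. -/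
theorem existsUnique_smul_eq [Finite W] (hm : IsMonoAction W B) (hp : p ∈ II r)
    (h : ∀ (w : W) i j, (mat p w i j).eval 1 = 0) :
    ∃! p' : IncFun W B, p' ∈ II r ∧ (X - 1 : ℤ[X]) • p' = p := by
  rw [mem_II_iff] at hp
  have hsmul : (X - 1 : ℤ[X]) • divXSubOne p = p := ext_mat fun w => Matrix.ext fun i j => by
    rw [mat_smul, Matrix.smul_apply, mat_apply, evFun_divXSubOne, smul_eq_mul]
    have := mul_divByMonic_eq_iff_isRoot.2 (h w i j)
    rwa [C_1] at this
  refine ⟨divXSubOne p, ⟨mem_II_iff.2 ⟨?_, fun w => ⟨fun i j hij => ?_, fun i j => ?_⟩⟩, hsmul⟩, ?_⟩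
  · exact isEquivariant_of_evFun_eq hm hp.1 (fun _ _ a => a /ₘ (X - C 1))
      (fun _ _ => zero_divByMonic _) (fun _ _ _ _ _ => rfl) evFun_divXSubOne
  · by_contra hle
    exact hij (mat_apply_of_not_le hle)
  · rw [mat_apply, evFun_divXSubOne, natDegree_divByMonic _ (monic_X_sub_C _)]
    exact (Nat.sub_le _ _).trans ((hp.2 w).deg i j)
  · rintro p' ⟨-, hp'⟩
    refine ext_mat fun w => smul_mat_cancel ?_
    rw [← mat_smul, ← mat_smul, hp', hsmul]

end Existence

section Joins

variable {Γ : Type*} [PartialOrder Γ] {q : Γ}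

theorem isLUB_pair_iff {z s : Γ} :
    IsLUB {z, q} s ↔ z ≤ s ∧ q ≤ s ∧ ∀ u, z ≤ u → q ≤ u → s ≤ u := by
  simp [IsLUB, IsLeast, upperBounds, lowerBounds, and_assoc]

theorem exists_eq_sigma_iff (hq : JoinAdmissible q) {z z' : Γ} :
    (∃ hz : z ∈ lowerPart q, z' = sigma hq ⟨z, hz⟩) ↔ ¬ q ≤ z ∧ IsLUB {z, q} z' := by
  constructor
  · rintro ⟨hz, rfl⟩
    exact ⟨hz, (hq z).choose_spec⟩
  · rintro ⟨hz, hz'⟩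
    exact ⟨hz, hz'.unique (hq z).choose_spec⟩

variable {W : Type*} [Group W] [MulAction W Γ]

theorem smul_le_iff (hm : IsMonoAction W Γ) (x : W) (z z' : Γ) : x • z ≤ z' ↔ z ≤ x⁻¹ • z' := by
  rw [← hm.smul_le_smul_iff x⁻¹, inv_smul_smul]

theorem isLUB_smul_iff (hm : IsMonoAction W Γ) (hfix : ∀ w : W, w • q = q) (x : W) (z s : Γ) :
    IsLUB {x • z, q} (x • s) ↔ IsLUB {z, q} s := by
  have hq : ∀ u, q ≤ x • u ↔ q ≤ u := fun u => by
    rw [← hm.smul_le_smul_iff x q u, hfix]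
  rw [isLUB_pair_iff, isLUB_pair_iff, hm.smul_le_smul_iff, hq]
  refine and_congr_right fun _ => and_congr_right fun _ => ⟨fun h u hu hu' => ?_, fun h u hu hu' => ?_⟩
  · rw [← hm.smul_le_smul_iff x]
    exact h _ (hm x _ _ hu) ((hq u).2 hu')
  · rw [smul_le_iff hm] at hu ⊢
    exact h _ hu ((hq _).1 (by rwa [smul_inv_smul]))

theorem isUpperSet_upperPart (w : W) :
    IsUpperSet (Subtype.val ⁻¹' upperPart q : Set (MulAction.fixedBy Γ w)) :=
  fun _ _ h h' => le_trans h' h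

theorem IsEquivariant.restrictXYo [Finite W] (hm : IsMonoAction W Γ) (hfix : ∀ w : W, w • q = q)
    (hq : JoinAdmissible q) {p : IncFun W Γ} (hp : IsEquivariant p) :
    IsEquivariant (restrictXYo hq p) := by
  refine hp.restrict hm fun x z z' => ?_
  rw [exists_eq_sigma_iff, exists_eq_sigma_iff, isLUB_smul_iff hm hfix,
    ← hm.smul_le_smul_iff x q z, hfix]

open Classical in
theorem mat_restrictXYo (hq : JoinAdmissible q) (p : IncFun W Γ) (w : W)
    (i j : MulAction.fixedBy Γ w) : mat (restrictXYo hq p) w i j =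
      if ¬ q ≤ (i : Γ) ∧ IsLUB {(i : Γ), q} (j : Γ) then mat p w i j else 0 := by
  rw [mat_apply, restrictXYo, evFun_restrict]
  simp only [exists_eq_sigma_iff]
  rfl

variable [Finite Γ] {r : Γ → Γ → ℕ} {p : IncFun W Γ} {w : W}

theorem projM_mul_mat_restrictXYo (hq : JoinAdmissible q) :
    projM (Subtype.val ⁻¹' upperPart q)ᶜ * mat (restrictXYo hq p) w *
      projM (Subtype.val ⁻¹' upperPart q) = mat (restrictXYo hq p) w := by
  classical
  ext1 i j
  rw [projM_mul_mul_apply, mat_restrictXYo]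
  by_cases h : ¬ q ≤ (i : Γ) ∧ IsLUB {(i : Γ), q} (j : Γ)
  · rw [if_pos]
    exact ⟨h.1, (isLUB_pair_iff.1 h.2).2.1⟩
  · rw [if_neg h, ite_self]

theorem mat_restrictXYo_mul (hm : IsMonoAction W Γ) (hfix : ∀ w : W, w • q = q)
    (hq : JoinAdmissible q)
    (hmul : ∀ i k j, i ≤ k → k ≤ j → mat p w i j = mat p w i k * mat p w k j) :
    mat (restrictXYo hq p) w *
        (projM (Subtype.val ⁻¹' upperPart q) * mat p w * projM (Subtype.val ⁻¹' upperPart q)) =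
      projM (Subtype.val ⁻¹' upperPart q)ᶜ * mat p w * projM (Subtype.val ⁻¹' upperPart q) := by
  classical
  ext1 i j
  rw [Matrix.mul_apply, projM_mul_mul_apply]
  simp only [mat_restrictXYo, projM_mul_mul_apply]
  by_cases hi : q ≤ (i : Γ)
  · rw [if_neg fun h => h.1 hi, Finset.sum_eq_zero]
    intro k _
    rw [if_neg fun h => h.1 hi, zero_mul]
  obtain ⟨s, hs⟩ := hq i
  have hws : w • s = s := by
    have h₁ := (isLUB_smul_iff hm hfix w i s).2 hs
    have hwi : w • (i : Γ) = i := i.2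
    rw [hwi] at h₁
    exact h₁.unique hs
  obtain ⟨his, hqs, hsmin⟩ := isLUB_pair_iff.1 hs
  rw [Finset.sum_eq_single ⟨s, hws⟩, if_pos ⟨hi, hs⟩]
  · by_cases hj : q ≤ (j : Γ)
    · rw [if_pos ⟨hqs, hj⟩, if_pos ⟨hi, hj⟩]
      by_cases hij : i ≤ j
      · exact (hmul i ⟨s, hws⟩ j his (hsmin _ hij hj)).symm
      · rw [mat_apply_of_not_le hij, mat_apply_of_not_le (i := ⟨s, hws⟩)
          fun h => hij (le_trans (b := ⟨s, hws⟩) his h), mul_zero]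
    · rw [if_neg fun h => hj h.2, if_neg fun h => hj h.2, mul_zero]
  · intro k _ hk
    rw [if_neg fun h => hk (Subtype.ext (h.2.unique hs)), zero_mul]
  · simp

omit [Finite Γ] in
theorem IsBounded.mat_restrictXYo (hq : JoinAdmissible q)
    (h : IsBounded (fixedRank r w) (mat p w)) :
    IsBounded (fixedRank r w) (mat (restrictXYo hq p) w) where
  le i j hij := by
    by_contra hle
    exact hij (mat_apply_of_not_le hle)
  deg i j := by
    rw [EquivKLS.mat_restrictXYo]
    split_ifs
    · exact h.deg i j
    · simp

theorem mat_restrictXYo_hatM (hq : JoinAdmissible q) {p' : IncFun W Γ}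
    {ρ : MulAction.fixedBy Γ w → ℤ} (h : mat p' w = hatM ρ (mat p w)) :
    mat (restrictXYo hq p') w = hatM ρ (mat (restrictXYo hq p) w) := by
  classical
  ext1 i j
  rw [hatM_apply, mat_restrictXYo, mat_restrictXYo, h, hatM_apply]
  split_ifs <;> simp

theorem mem_II_mul [Finite W] (hm : IsMonoAction W Γ) (hr : IsWeakRank r) {p' : IncFun W Γ}
    (hp : p ∈ II r) (hp' : p' ∈ II r) : p * p' ∈ II r := by
  rw [mem_II_iff] at hp hp' ⊢
  refine ⟨hp.1.mul hm hp'.1, fun w => ?_⟩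
  rw [mat_mul hm hp.1 hp'.1]
  exact (hp.2 w).mul (hr.fixedRank w) (hp'.2 w)

omit [Finite Γ] in
theorem mem_II_restrictXYo [Finite W] (hm : IsMonoAction W Γ) (hfix : ∀ w : W, w • q = q)
    (hq : JoinAdmissible q) (hp : p ∈ II r) : restrictXYo hq p ∈ II r := by
  rw [mem_II_iff] at hp ⊢
  exact ⟨hp.1.restrictXYo hm hfix hq, fun w => (hp.2 w).mat_restrictXYo hq⟩

omit [Finite Γ] in
theorem mem_II_rev [Finite W] (hm : IsMonoAction W Γ) (hrW : IsInvariantRank W r)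
    (hp : p ∈ II r) : rev r p ∈ II r := by
  rw [mem_II_iff] at hp ⊢
  refine ⟨hp.1.rev hm hrW, fun w => ?_⟩
  rw [mat_rev]
  exact (hp.2 w).revM

/-- To recognize the hat of an element, it suffices to use one rank function of each fixed
poset. -/
theorem isHat_of_exists [Finite W] {p' : IncFun W Γ} (hp : p ∈ II r)
    (h : ∀ w : W, ∃ ρ : MulAction.fixedBy Γ w → ℤ, IsRankFunction ρ ∧
      mat p' w = hatM ρ (mat p w)) : IsHat p p' := by
  rw [isHat_iff]
  intro w ρ' hρ'
  obtain ⟨ρ, hρ, h'⟩ := h w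
  rw [h', ((mem_II_iff.1 hp).2 w).hatM_eq_hatM hρ hρ']

theorem existsUnique_isHat [Finite W] (heul : ∀ w : W, IsLowerEulerian (MulAction.fixedBy Γ w))
    {p' : IncFun W Γ} (hp' : p' ∈ II r) (h : IsHat p p') : ∃! l, l ∈ II r ∧ IsHat p l := by
  refine ⟨p', ⟨hp', h⟩, fun l hl => ext_mat fun w => ?_⟩
  obtain ⟨ρ, hρ⟩ := heul w
  rw [isHat_iff.1 h w ρ hρ.rank, isHat_iff.1 hl.2 w ρ hρ.rank]

end Joins

section MainResults

variable {W Γ : Type*} [Group W] [Finite W] [PartialOrder Γ] [Finite Γ] [MulAction W Γ]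
  {r : Γ → Γ → ℕ} {κ f g : IncFun W Γ}

/-- A rank alternating multiplicative element of the equivariant incidence algebra of a poset
with an action such that all fixed posets are lower Eulerian. -/
structure IsAlternatingKernel (r : Γ → Γ → ℕ) (κ : IncFun W Γ) : Prop where
  mono : IsMonoAction W Γ
  eulerian : ∀ w : W, IsLowerEulerian (MulAction.fixedBy Γ w)
  weak : IsWeakRank r
  inv : IsInvariantRank W r
  mem_II : κ ∈ II r
  mem_UU : κ ∈ UU W Γ
  multiplicative : IsMultiplicative κ
  alternating : IsRankAlternating r κ

namespace IsAlternatingKernel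

variable (H : IsAlternatingKernel r κ)

include H

omit [Finite W] [Finite Γ] in
theorem mat_mul_apply (w : W) (i k j : MulAction.fixedBy Γ w) (h : i ≤ k) (h' : k ≤ j) :
    mat κ w i j = mat κ w i k * mat κ w k j := by
  rw [mat_apply, evFun_eq κ (h.trans h') i.2 j.2, mat_apply, evFun_eq κ h i.2 k.2, mat_apply,
    evFun_eq κ h' k.2 j.2]
  exact H.multiplicative w i k j h h' i.2 k.2 j.2

omit [Finite W] in
theorem revM_eq {w : W} {ρ : MulAction.fixedBy Γ w → ℤ} (hρ : IsRankFunction ρ) :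
    revM (fixedRank r w) (mat κ w) = hatM ρ (mat κ w) := by
  rw [← mat_rev]
  exact isHat_iff.1 H.alternating w ρ hρ

theorem mul_hatM {w : W} {ρ : MulAction.fixedBy Γ w → ℤ} (hρ : IsLowerEulerianWith ρ) :
    mat κ w * hatM ρ (mat κ w) = 1 :=
  mul_hatM_eq_one ((mem_II_iff.1 H.mem_II).2 w) ((mem_UU_iff.1 H.mem_UU).2 w) (H.mat_mul_apply w) hρ

theorem mul_revM (w : W) : mat κ w * revM (fixedRank r w) (mat κ w) = 1 := by
  obtain ⟨ρ, hρ⟩ := H.eulerian w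
  rw [H.revM_eq hρ.rank, H.mul_hatM hρ]

theorem revM_mul (w : W) : revM (fixedRank r w) (mat κ w) * mat κ w = 1 :=
  mul_eq_one_comm.1 (H.mul_revM w)

theorem isKernel : IsKernel r κ := by
  have hrev := H.mem_II.1.rev H.mono H.inv
  refine ⟨H.mem_II, H.mem_UU, hrev, ext_mat fun w => ?_, ext_mat fun w => ?_⟩
  · rw [mat_mul H.mono H.mem_II.1 hrev, mat_rev, H.mul_revM, mat_one]
  · rw [mat_mul H.mono hrev H.mem_II.1, mat_rev, H.revM_mul, mat_one]

theorem isKLSTriple (hf : IsRightKLS r κ f) (hg : IsLeftKLS r κ g) {w : W}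
    {ρ : MulAction.fixedBy Γ w → ℤ} (hρ : IsLowerEulerianWith ρ) :
    IsKLSTriple (fixedRank r w) ρ (mat κ w) (mat f w) (mat g w) where
  weak := H.weak.fixedRank w
  bdd := (mem_II_iff.1 H.mem_II).2 w
  mul_hat := H.mul_hatM hρ
  right := ((mem_IIHalf_iff H.weak).1 hf.1).2 w
  right_diag := (mem_UU_iff.1 hf.2.1).2 w
  right_rev := by rw [← mat_rev, hf.2.2, mat_mul H.mono H.mem_II.1 hf.2.1.1]
  left := ((mem_IIHalf_iff H.weak).1 hg.1).2 w
  left_diag := (mem_UU_iff.1 hg.2.1).2 w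
  left_rev := by rw [← mat_rev, hg.2.2, mat_mul H.mono hg.2.1.1 H.mem_II.1]

theorem existsUnique_isRightKLS : ∃! f, IsRightKLS r κ f := by
  obtain ⟨g, hg⟩ := exists_isLeftKLS H.mono H.weak H.inv H.mem_II H.mem_UU H.mul_revM
  obtain ⟨f, hf⟩ := exists_isRightKLS H.mono H.weak H.inv H.mem_II H.mem_UU H.revM_mul
  refine ⟨f, hf, fun f' hf' => ext_mat fun w => ?_⟩
  obtain ⟨ρ, hρ⟩ := H.eulerian w
  have := left_inv_eq_right_inv (H.isKLSTriple hf' hg hρ).hat_mul_left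
    (H.isKLSTriple hf hg hρ).left_mul_hat
  rw [← hatM_hatM (ρ := ρ) (M := mat f' w), this, hatM_hatM]

theorem existsUnique_isLeftKLS : ∃! g, IsLeftKLS r κ g := by
  obtain ⟨g, hg⟩ := exists_isLeftKLS H.mono H.weak H.inv H.mem_II H.mem_UU H.mul_revM
  obtain ⟨f, hf⟩ := exists_isRightKLS H.mono H.weak H.inv H.mem_II H.mem_UU H.revM_mul
  refine ⟨g, hg, fun g' hg' => ext_mat fun w => ?_⟩
  obtain ⟨ρ, hρ⟩ := H.eulerian w
  exact left_inv_eq_right_inv (H.isKLSTriple hf hg' hρ).left_mul_hat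
    (H.isKLSTriple hf hg hρ).hat_mul_left

theorem isRightKLS : IsRightKLS r κ (rightKLS r κ) := the_spec H.existsUnique_isRightKLS

theorem isLeftKLS : IsLeftKLS r κ (leftKLS r κ) := the_spec H.existsUnique_isLeftKLS

theorem triple {w : W} {ρ : MulAction.fixedBy Γ w → ℤ} (hρ : IsLowerEulerianWith ρ) :
    IsKLSTriple (fixedRank r w) ρ (mat κ w) (mat (rightKLS r κ) w) (mat (leftKLS r κ) w) :=
  H.isKLSTriple H.isRightKLS H.isLeftKLS hρ

theorem existsUnique_isInverse_leftKLS : ∃! g', IsInverse (leftKLS r κ) g' :=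
  existsUnique_isInverse H.mono H.weak H.isLeftKLS.2.1

theorem isInverse_leftKLS : IsInverse (leftKLS r κ) (inverse (leftKLS r κ)) :=
  the_spec H.existsUnique_isInverse_leftKLS

theorem mat_inverse_leftKLS {w : W} {ρ : MulAction.fixedBy Γ w → ℤ} (hρ : IsLowerEulerianWith ρ) :
    mat (inverse (leftKLS r κ)) w = hatM ρ (mat (rightKLS r κ) w) :=
  H.isInverse_leftKLS.mat_eq H.mono H.isLeftKLS.2.1.1 (H.triple hρ).left_mul_hat

theorem inverse_leftKLS_mem_II : inverse (leftKLS r κ) ∈ II r :=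
  mem_II_iff.2 ⟨H.isInverse_leftKLS.1, fun w => by
    obtain ⟨ρ, hρ⟩ := H.eulerian w
    rw [H.mat_inverse_leftKLS hρ]
    exact ((mem_II_iff.1 H.isRightKLS.1.1).2 w).hatM⟩

theorem isHat_rightKLS : IsHat (rightKLS r κ) (inverse (leftKLS r κ)) :=
  isHat_of_exists H.isRightKLS.1.1 fun w => by
    obtain ⟨ρ, hρ⟩ := H.eulerian w
    exact ⟨ρ, hρ.rank, H.mat_inverse_leftKLS hρ⟩

theorem existsUnique_hat_rightKLS : ∃! f', f' ∈ II r ∧ IsHat (rightKLS r κ) f' :=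
  existsUnique_isHat H.eulerian H.inverse_leftKLS_mem_II H.isHat_rightKLS

theorem hat_rightKLS : hat r (rightKLS r κ) = inverse (leftKLS r κ) :=
  H.existsUnique_hat_rightKLS.unique (the_spec H.existsUnique_hat_rightKLS)
    ⟨H.inverse_leftKLS_mem_II, H.isHat_rightKLS⟩

/-! ### The `h`-polynomials and local `h`-polynomials of `σ` -/

variable {q : Γ} (hfix : ∀ w : W, w • q = q) (hq : JoinAdmissible q)

include hfix

theorem existsUnique_isHPoly : ∃! h, IsHPoly r κ hq h := by
  have hres := mem_II_restrictXYo H.mono hfix hq H.mem_II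
  refine existsUnique_smul_eq H.mono (mem_II_mul H.mono H.weak H.isLeftKLS.1.1 hres)
    fun w i j => ?_
  classical
  obtain ⟨ρ, hρ⟩ := H.eulerian w
  rw [mat_mul H.mono H.isLeftKLS.1.1.1 hres.1, Matrix.mul_apply, eval_finsetSum]
  refine Finset.sum_eq_zero fun k _ => ?_
  rw [eval_mul, mat_restrictXYo]
  split_ifs with h
  · have hkj := isLUB_pair_iff.1 h.2
    have hlt : k < j := lt_of_le_of_ne hkj.1 fun h' => h.1 (h' ▸ hkj.2.1)
    rw [eval_one_eq_zero ((mem_II_iff.1 H.mem_II).2 w) (H.mat_mul_apply w) hρ.rank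
      (H.revM_eq hρ.rank) hlt, mul_zero]
  · simp

theorem isHPoly : IsHPoly r κ hq (hPoly r κ hq) := the_spec (H.existsUnique_isHPoly hfix hq)

theorem localH_mem_II : localH r κ hq ∈ II r :=
  mem_II_mul H.mono H.weak (H.isHPoly hfix hq).1 H.inverse_leftKLS_mem_II

theorem smul_mat_localH {w : W} {ρ : MulAction.fixedBy Γ w → ℤ} (hρ : IsLowerEulerianWith ρ) :
    (X - 1 : ℂ[X]) • mat (localH r κ hq) w =
      mat (leftKLS r κ) w * mat (restrictXYo hq κ) w * hatM ρ (mat (rightKLS r κ) w) := by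
  rw [localH, mat_mul H.mono (H.isHPoly hfix hq).1.1 H.isInverse_leftKLS.1,
    H.mat_inverse_leftKLS hρ, ← Matrix.smul_mul, ← mat_smul, (H.isHPoly hfix hq).2,
    mat_mul H.mono H.isLeftKLS.1.1.1 (H.mem_II.1.restrictXYo H.mono hfix hq)]

theorem deltaM_mat_localH {w : W} {ρ : MulAction.fixedBy Γ w → ℤ} (hρ : IsLowerEulerianWith ρ) :
    deltaM (fixedRank r w) (mat (localH r κ hq) w) =
      projM (Subtype.val ⁻¹' upperPart q)ᶜ * mat (leftKLS r κ) w *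
        projM (Subtype.val ⁻¹' upperPart q) * hatM ρ (mat (rightKLS r κ) w) :=
  (H.triple hρ).deltaM_eq (isUpperSet_upperPart w) (projM_mul_mat_restrictXYo hq)
    (mat_restrictXYo_mul H.mono hfix hq (H.mat_mul_apply w)) (H.smul_mat_localH hfix hq hρ)

theorem existsUnique_hat_localH : ∃! l, l ∈ II r ∧ IsHat (localH r κ hq) l := by
  have hf := H.isRightKLS.1.1
  obtain ⟨f', hf'⟩ := exists_isInverse H.mono H.weak H.isRightKLS.2.1
  have hf'mat : ∀ (w : W) (ρ : MulAction.fixedBy Γ w → ℤ), IsLowerEulerianWith ρ →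
      mat f' w = hatM ρ (mat (leftKLS r κ) w) := fun w ρ hρ =>
    hf'.mat_eq H.mono hf.1 (H.triple hρ).right_mul_hat
  have hf'mem : f' ∈ II r := mem_II_iff.2 ⟨hf'.1, fun w => by
    obtain ⟨ρ, hρ⟩ := H.eulerian w
    rw [hf'mat w ρ hρ]
    exact ((mem_II_iff.1 H.isLeftKLS.1.1).2 w).hatM⟩
  have hres := mem_II_restrictXYo H.mono hfix hq (mem_II_rev H.mono H.inv H.mem_II)
  have hmem₁ := mem_II_mul H.mono H.weak hf'mem hres
  have hmem := mem_II_mul H.mono H.weak hmem₁ hf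
  have hmat : ∀ (w : W) (ρ : MulAction.fixedBy Γ w → ℤ), IsLowerEulerianWith ρ →
      mat (f' * restrictXYo hq (rev r κ) * rightKLS r κ) w =
        (X - 1 : ℂ[X]) • hatM ρ (mat (localH r κ hq) w) := fun w ρ hρ => by
    rw [mat_mul H.mono hmem₁.1 hf.1, mat_mul H.mono hf'mem.1 hres.1, hf'mat w ρ hρ,
      mat_restrictXYo_hatM hq (isHat_iff.1 H.alternating w ρ hρ.rank), ← hatM_smul,
      H.smul_mat_localH hfix hq hρ, hatM_mul, hatM_mul, hatM_hatM]
  obtain ⟨l, ⟨hl, hsmul⟩, -⟩ := existsUnique_smul_eq H.mono hmem fun w i j => by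
    obtain ⟨ρ, hρ⟩ := H.eulerian w
    rw [hmat w ρ hρ, Matrix.smul_apply, smul_eq_mul, eval_mul]
    simp
  refine existsUnique_isHat H.eulerian hl
    (isHat_of_exists (H.localH_mem_II hfix hq) fun w => ?_)
  obtain ⟨ρ, hρ⟩ := H.eulerian w
  refine ⟨ρ, hρ.rank, smul_mat_cancel ?_⟩
  rw [← mat_smul, hsmul, hmat w ρ hρ]

theorem hat_localH_mem_II : hat r (localH r κ hq) ∈ II r :=
  (the_spec (H.existsUnique_hat_localH hfix hq)).1

theorem mat_hat_localH {w : W} {ρ : MulAction.fixedBy Γ w → ℤ} (hρ : IsRankFunction ρ) :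
    mat (hat r (localH r κ hq)) w = hatM ρ (mat (localH r κ hq) w) :=
  isHat_iff.1 (the_spec (H.existsUnique_hat_localH hfix hq)).2 w ρ hρ

omit [Finite W] H hfix in
theorem mat_restrictXY (p : IncFun W Γ) (w : W) : mat (restrictXY q p) w =
    projM (Subtype.val ⁻¹' upperPart q)ᶜ * mat p w * projM (Subtype.val ⁻¹' upperPart q) :=
  mat_restrict (lowerPart q) (upperPart q)

omit [Finite W] H hfix in
theorem mat_restrictX (p : IncFun W Γ) (w : W) : mat (restrictX q p) w =
    projM (Subtype.val ⁻¹' upperPart q)ᶜ * mat p w * projM (Subtype.val ⁻¹' upperPart q)ᶜ :=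
  mat_restrict (lowerPart q) (lowerPart q)

omit [Finite W] H hfix in
theorem mat_restrictY (p : IncFun W Γ) (w : W) : mat (restrictY q p) w =
    projM (Subtype.val ⁻¹' upperPart q) * mat p w * projM (Subtype.val ⁻¹' upperPart q) :=
  mat_restrict (upperPart q) (upperPart q)

omit [Finite W] [Finite Γ] in
theorem smul_mem_upperPart (w : W) (z : Γ) : w • z ∈ upperPart q ↔ z ∈ upperPart q := by
  change q ≤ w • z ↔ q ≤ z
  rw [← H.mono.smul_le_smul_iff w q z, hfix]

omit [Finite W] [Finite Γ] in
theorem smul_mem_lowerPart (w : W) (z : Γ) : w • z ∈ lowerPart q ↔ z ∈ lowerPart q :=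
  not_congr (H.smul_mem_upperPart hfix w z)

omit [Finite Γ] in
theorem equivariant_restrictX {p : IncFun W Γ} (hp : IsEquivariant p) :
    IsEquivariant (restrictX q p) :=
  hp.restrict H.mono fun x z z' => by
    rw [H.smul_mem_lowerPart hfix, H.smul_mem_lowerPart hfix]

omit [Finite Γ] in
theorem equivariant_restrictY {p : IncFun W Γ} (hp : IsEquivariant p) :
    IsEquivariant (restrictY q p) :=
  hp.restrict H.mono fun x z z' => by
    rw [H.smul_mem_upperPart hfix, H.smul_mem_upperPart hfix]

omit [Finite Γ] in
theorem equivariant_restrictXY {p : IncFun W Γ} (hp : IsEquivariant p) :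
    IsEquivariant (restrictXY q p) :=
  hp.restrict H.mono fun x z z' => by
    rw [H.smul_mem_lowerPart hfix, H.smul_mem_upperPart hfix]

theorem Delta_localH_equivariant : IsEquivariant (Delta r (localH r κ hq)) :=
  (H.localH_mem_II hfix hq).1.Delta H.mono H.inv

theorem Delta_hat_localH_equivariant : IsEquivariant (Delta r (hat r (localH r κ hq))) :=
  (H.hat_localH_mem_II hfix hq).1.Delta H.mono H.inv

theorem restrictXY_leftKLS :
    restrictXY q (leftKLS r κ) = Delta r (localH r κ hq) * leftKLS r κ := by
  refine ext_mat fun w => ?_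
  obtain ⟨ρ, hρ⟩ := H.eulerian w
  rw [mat_restrictXY, mat_mul H.mono (H.Delta_localH_equivariant hfix hq) H.isLeftKLS.2.1.1,
    mat_Delta, (H.triple hρ).deltaM_mul_left (H.deltaM_mat_localH hfix hq hρ)]

theorem restrictXY_leftKLS_upper :
    restrictXY q (leftKLS r κ) = Delta r (localH r κ hq) * restrictY q (leftKLS r κ) := by
  refine ext_mat fun w => ?_
  obtain ⟨ρ, hρ⟩ := H.eulerian w
  rw [mat_restrictXY, mat_mul H.mono (H.Delta_localH_equivariant hfix hq)
      (H.equivariant_restrictY hfix H.isLeftKLS.2.1.1), mat_Delta, mat_restrictY,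
    (H.triple hρ).deltaM_mul_left_upper (isUpperSet_upperPart w) (H.deltaM_mat_localH hfix hq hρ)]

theorem restrictXY_rightKLS :
    restrictXY q (rightKLS r κ) = -(rightKLS r κ * Delta r (hat r (localH r κ hq))) := by
  refine ext_mat fun w => ?_
  obtain ⟨ρ, hρ⟩ := H.eulerian w
  rw [mat_restrictXY, mat_neg, mat_mul H.mono H.isRightKLS.2.1.1
      (H.Delta_hat_localH_equivariant hfix hq), mat_Delta, H.mat_hat_localH hfix hq hρ.rank,
    (H.triple hρ).right_mul_deltaM_hat (isUpperSet_upperPart w) (H.deltaM_mat_localH hfix hq hρ),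
    neg_neg]

theorem restrictXY_rightKLS_lower :
    restrictXY q (rightKLS r κ) =
      -(restrictX q (rightKLS r κ) * Delta r (hat r (localH r κ hq))) := by
  refine ext_mat fun w => ?_
  obtain ⟨ρ, hρ⟩ := H.eulerian w
  rw [mat_restrictXY, mat_neg, mat_mul H.mono (H.equivariant_restrictX hfix H.isRightKLS.2.1.1)
      (H.Delta_hat_localH_equivariant hfix hq), mat_Delta, H.mat_hat_localH hfix hq hρ.rank,
    mat_restrictX, (H.triple hρ).right_lower_mul_deltaM_hat (isUpperSet_upperPart w)
      (H.deltaM_mat_localH hfix hq hρ), neg_neg]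

theorem restrictXY_zFun :
    restrictXY q (zFun r κ) =
      -(restrictX q (zFun r κ) * Delta r (hat r (localH r κ hq))) +
        rev r (Delta r (localH r κ hq)) * restrictY q (zFun r κ) := by
  have hgκ : IsEquivariant (leftKLS r κ * κ) := H.isLeftKLS.2.1.1.mul H.mono H.mem_II.1
  have hz : IsEquivariant (zFun r κ) := hgκ.mul H.mono H.isRightKLS.2.1.1
  refine ext_mat fun w => ?_
  obtain ⟨ρ, hρ⟩ := H.eulerian w
  rw [mat_restrictXY, mat_add, mat_neg, mat_mul H.mono (H.equivariant_restrictX hfix hz)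
      (H.Delta_hat_localH_equivariant hfix hq), mat_Delta, H.mat_hat_localH hfix hq hρ.rank,
    mat_restrictX, mat_mul H.mono ((H.Delta_localH_equivariant hfix hq).rev H.mono H.inv)
      (H.equivariant_restrictY hfix hz), mat_restrictY, mat_rev, mat_Delta, zFun,
    mat_mul H.mono hgκ H.isRightKLS.2.1.1, mat_mul H.mono H.isLeftKLS.2.1.1 H.mem_II.1]
  exact (H.triple hρ).Z_block (isUpperSet_upperPart w) (H.deltaM_mat_localH hfix hq hρ)

theorem Delta_localH :
    Delta r (localH r κ hq) = restrictXY q (leftKLS r κ) * inverse (leftKLS r κ) := by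
  refine ext_mat fun w => ?_
  obtain ⟨ρ, hρ⟩ := H.eulerian w
  rw [mat_Delta, mat_mul H.mono (H.equivariant_restrictXY hfix H.isLeftKLS.2.1.1)
    H.isInverse_leftKLS.1, mat_restrictXY, H.mat_inverse_leftKLS hρ,
    H.deltaM_mat_localH hfix hq hρ]

end IsAlternatingKernel

end MainResults

end

end EquivKLS

open EquivKLS
theorem theorem4p14 {W Γ : Type*} [Group W] [Finite W] [PartialOrder Γ] [Finite Γ]
    [MulAction W Γ] (ρ : Γ → ℤ) (q : Γ) (hΓ : IsTriple ρ q) (hW : IsEulerianAction W ρ q)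
    (r : Γ → Γ → ℕ) (hr : IsWeakRank r) (hrW : IsInvariantRank W r)
    (κ : IncFun W Γ) (hκ : κ ∈ II r) (hκU : κ ∈ UU W Γ)
    (hmul : IsMultiplicative κ) (halt : IsRankAlternating r κ) :
    -- all the objects in the identities below are well defined
    (IsKernel r κ ∧
      (∃! f, IsRightKLS r κ f) ∧
      (∃! g, IsLeftKLS r κ g) ∧
      (∃! g', IsInverse (leftKLS r κ) g') ∧
      (∃! h, IsHPoly r κ hΓ.join h) ∧
      localH r κ hΓ.join ∈ II r ∧
      (∃! l, l ∈ II r ∧ IsHat (localH r κ hΓ.join) l) ∧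
      (∃! f', f' ∈ II r ∧ IsHat (rightKLS r κ) f')) ∧
    -- the identities for the left function `g`
    (restrictXY q (leftKLS r κ) = Delta r (localH r κ hΓ.join) * leftKLS r κ ∧
      restrictXY q (leftKLS r κ) =
        Delta r (localH r κ hΓ.join) * restrictY q (leftKLS r κ)) ∧
    -- the identities for the right function `f`
    (restrictXY q (rightKLS r κ) = -(rightKLS r κ * Delta r (hat r (localH r κ hΓ.join))) ∧
      restrictXY q (rightKLS r κ) =
        -(restrictX q (rightKLS r κ) * Delta r (hat r (localH r κ hΓ.join)))) ∧
    -- the identity for the `Z`-function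
    restrictXY q (zFun r κ) =
      -(restrictX q (zFun r κ) * Delta r (hat r (localH r κ hΓ.join))) +
        rev r (Delta r (localH r κ hΓ.join)) * restrictY q (zFun r κ) ∧
    -- the local polynomials in terms of `g` and `f`
    (Delta r (localH r κ hΓ.join) = restrictXY q (leftKLS r κ) * inverse (leftKLS r κ) ∧
      Delta r (localH r κ hΓ.join) = restrictXY q (leftKLS r κ) * hat r (rightKLS r κ)) := by
  have H : IsAlternatingKernel r κ := ⟨hW.mono, hW.eulerian, hr, hrW, hκ, hκU, hmul, halt⟩
  have hfix := hW.fix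
  have hq := hΓ.join
  exact ⟨⟨H.isKernel, H.existsUnique_isRightKLS, H.existsUnique_isLeftKLS,
      H.existsUnique_isInverse_leftKLS, H.existsUnique_isHPoly hfix hq, H.localH_mem_II hfix hq,
      H.existsUnique_hat_localH hfix hq, H.existsUnique_hat_rightKLS⟩,
    ⟨H.restrictXY_leftKLS hfix hq, H.restrictXY_leftKLS_upper hfix hq⟩,
    ⟨H.restrictXY_rightKLS hfix hq, H.restrictXY_rightKLS_lower hfix hq⟩,
    H.restrictXY_zFun hfix hq,
    ⟨H.Delta_localH hfix hq, H.hat_rightKLS ▸ H.Delta_localH hfix hq⟩⟩
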